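/- **Setting.** Let $t_0<t_f$, $N\ge 1$, $t_k=t_0+\frac kN(t_f-t_0)$. Consider the incremental system $\dot\eta=A(t)\eta+B(t)\xi+F(t)w+E\,\delta p$, $\delta q=C\eta+D\xi+Gw$ around a nominal trajectory $(\bar x,\bar u)$, a matrix function $T=\begin{bmatrix}T_{11}&T_{12}\\T_{21}&T_{22}\end{bmatrix}$ with $T(t),T_{22}(t)$ nonsingular, $\alpha\ge0$, $c_Q\ge 0$, and polytopic constraints $a^h_i(t)^\top x\le b^h_i(t)$, $a^g_j(t)^\top u\le b^g_j(t)$; all functions of time ($A,B,F,T,T_{22}^{-1},\bar x,\bar u,a^h_i,b^h_i,a^g_j,b^g_j$) are measurable and bounded on $[t_0,t_f]$. The decision variables are a matrix $Q$ and $\zeta=(Y,Z,N_1,N_2,\lambda_w,s)$ ($Q,Z,N_1,N_2$ square). Put $\Lambda=T_{12}T_{22}^{-1}$, $\Sigma=T_{11}-T_{12}T_{22}^{-1}T_{21}$, and $$H_{11}=AQ+BY-ET_{22}^{-1}T_{21}(CQ+DY)+\tfrac\alpha2Q,\quad H_{12}=\begin{bmatrix}N_2T_{22}^{-\top}E^\top\\F^\top-G^\top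 T_{21}^\top T_{22}^{-\top}E^\top\\\Sigma(CQ+DY)\end{bmatrix},\quad H_{22}=\begin{bmatrix}-N_2&\star&\star\\0&-\lambda_wI&\star\\\Lambda N_2&\Sigma G&-N_1\end{bmatrix}.$$ The funnel dynamics are either $\dot Q=H_{11}+H_{11}^\top+Z$ (Lyapunov type) or $\dot Q=Z$ (direct type). The matrix inequalities $L_l(t,Q,\zeta)\preceq0$ are: the invariance condition with $L=\begin{bmatrix}X&\star\\H_{12}&H_{22}\end{bmatrix}$, where $X=-Z$, respectively $X=H_{11}+H_{11}^\top-Z$; the state and input constraints with $$L=-\begin{bmatrix}(b^h_i-a_i^{h\top}\bar x)^2&c_Qa_i^{h\top}Q\\\star&c_QQ\end{bmatrix},\qquad L=-\begin{bmatrix}(b^g_j-a_j^{g\top}\bar u)^2&c_Qa_j^{g\top}Y\\\star&c_QQ\end{bmatrix};$$ and, for L-smooth nonlinearities, $L=-\begin{bmatrix}s_iI&C_iQ+D_iY\\\star&Q\end{bmatrix}$ for each channel $i$, where $C_i,D_i$ are the rows of $C,D$ of that channel. The admissible multipliers $(N_1,N_2)\in\mathcal N(t)$ are: $(\lambda S_1,\lambda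 S_2)$, $\lambda\ge0$ (sector bound; with weight $S$ one has $S_1=S_2=S$); or block-diagonal, with blocks $(\lambda_iI,\lambda_i\gamma_i(t)^2I)$ in channel $i$, $\lambda_i\ge0$ (Lipschitz); or with blocks $(\lambda_iI,\lambda_is_i\beta_i(t)^2I)$ with fixed $\lambda_i\ge0$ and variables $s_i\ge0$ (L-smooth; otherwise there is no $s$); or any other closed convex sets $\mathcal N(t)$ of pairs. On $[t_k,t_{k+1}]$, $\zeta(t)$ interpolates linearly between $\zeta_k^m$ and $\zeta_{k+1}^p$, and $Q(t)$ is the solution of the funnel dynamics with $Q(t_k)=Q_k$. With $\chi_k=(Q_k,\zeta_k^m,\zeta_{k+1}^p)$, vectorized and with the Euclidean norm, write $L_l(t,\chi_k)=L_l(t,Q(t),\zeta(t))$, which is affine in $\chi_k$, and, for exponents $p_l\ge1$, $$h_k^l(\chi_k)=\int_{t_k}^{t_{k+1}}\max\bigl(0,\lambda_{\max}(L_l(t,\chi_k))\bigr)^{p_l}dt .$$ (For non-symmetric arguments $\lambda_{\max}$ refers to the symmetric part.) Let $W(t,\chi_k)$ be $1/M$ times the sum of $v_iv_i^\top$ over an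 orthonormal basis $(v_i)$ of the eigenspace of the largest eigenvalue, $M$ its multiplicity, and let $$g_k^l(\chi_k)=\int_{t_k}^{t_{k+1}}\frac{\partial\max(0,\lambda_{\max})^{p_l}}{\partial\lambda_{\max}}\;\frac{\partial\,\mathrm{vec}\,L_l}{\partial\chi_k}\,\mathrm{vec}\,W\;dt$$ be the chosen subgradient of $h_k^l$ (for $p_l=1$ the derivative of $\max(0,\cdot)$ at $0$ is taken to be $0$). Let $J$ be a closed convex function of $Q_0$, finite on a convex set $\operatorname{dom}J$ containing the positive definite matrices, let $Q_f\succ0$ and $\epsilon>0$. Let $\mathcal C$ be the set of all $z=(\chi_0,\dots,\chi_{N-1},Q_N)$ with $Q_0\in\operatorname{dom}J$ such that: $Q_{k+1}=Q(t_{k+1})$ for all $k<N$ (discretized funnel dynamics); at $(t_k,Q_k,\zeta_k^m)$ and at $(t_{k+1},Q_{k+1},\zeta_{k+1}^p)$, $k<N$, the matrices $Q,Z,N_1,N_2$ are symmetric, all $L_l\preceq0$, $(N_1,N_2)\in\mathcal N$ and $0\le\lambda_w\le\alpha$; and $Q_N\preceq Q_f$. The $\epsilon$-relaxed CTCS funnel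 synthesis problem is $$\min_{z\in\mathcal C}J(Q_0)\quad\text{subject to}\quad h_k^l(\chi_k)\le\epsilon\ \text{ for all }k<N\text{ and all }l.\tag{P}$$ For weights $w_h,w_{tr}>0$, an SCvx sequence is a sequence $(z^{(i)})_{i\ge0}$, with arbitrary initial guess $z^{(0)}$, such that for each $i$, with $\bar z=z^{(i)}$, the point $z^{(i+1)}$ minimizes over $z\in\mathcal C$ $$J(Q_0)+w_h\sum_{k,l}\max\bigl(0,\;h_k^l(\bar\chi_k)+g_k^l(\bar\chi_k)^\top(\chi_k-\bar\chi_k)-\epsilon\bigr)+w_{tr}\Bigl(\sum_k\|\chi_k-\bar\chi_k\|^2+\|Q_N-\bar Q_N\|_F^2\Bigr).$$ **Statement.** Suppose that (P) has a solution (a global minimizer) and that some $z\in\mathcal C$ satisfies $h_k^l(\chi_k)<\epsilon$ for all $k,l$. Then there is $\bar w\in\mathbb R$, depending only on (P), such that the following holds for all $w_h,w_{tr}>0$, all constants $\beta_k^l\ge0$ such that $$\|g_k^l(\chi_k)-g_k^l(\chi_k')\|\le\beta_k^l\|\chi_k-\chi_k'\|\quad\text{for all }z,z'\in\mathcal C\text{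 and all }k,l,\qquad\text{and}\qquad w_h\sum_l\beta_k^l\le2w_{tr}\ \text{ for all }k,$$ and all SCvx sequences $(z^{(i)})$ such that, for all $i,k,l$ and almost every $t\in[t_k,t_{k+1}]$, the maximum eigenvalue of $L_l(t,\chi_k^{(i)})$ is simple: 1. for all $i,k$ and all $l$ with $p_l>1$, $h_k^l$ is differentiable at $\chi_k^{(i)}$ and $g_k^l(\chi_k^{(i)})$ is its gradient there; 2. if $w_h>\bar w$, the sequence $(z^{(i)})$ converges to a solution of (P); 3. for every $w_h>0$, each cluster point of $(z^{(i)})$ that is feasible for (P) is a solution of (P). -/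

import Mathlib

open Set Filter Topology MeasureTheory
open scoped NNReal Gradient

noncomputable section

/-! ### Largest eigenvalue, its multiplicity and the averaged top eigenprojection -/

section Eigen

variable {n : Type*} [Fintype n] [DecidableEq n]

/-- Symmetric part of a real square matrix; it is the matrix itself when that is symmetric. -/
def symPart (M : Matrix n n ℝ) : Matrix n n ℝ := (1 / 2 : ℝ) • (M + M.transpose)

theorem isHermitian_symPart (M : Matrix n n ℝ) : (symPart M).IsHermitian := by
  unfold Matrix.IsHermitian symPart
  ext i j
  simp [Matrix.conjTranspose_apply]
  ring

/-- The eigenvalues of (the symmetric part of) `M`, with multiplicity. -/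
def symEig (M : Matrix n n ℝ) : n → ℝ := (isHermitian_symPart M).eigenvalues

/-- An orthonormal family of eigenvectors belonging to `symEig M`. -/
def symEigVec (M : Matrix n n ℝ) (i : n) : n → ℝ :=
  WithLp.ofLp ((isHermitian_symPart M).eigenvectorBasis i)

/-- The largest eigenvalue of the symmetric matrix `M`. -/
def lamMax (M : Matrix n n ℝ) : ℝ := ⨆ i, symEig M i

open Classical in
/-- The indices of the eigenvalues that are equal to the largest one. -/
def topIdx (M : Matrix n n ℝ) : Finset n := Finset.univ.filter fun i => symEig M i = lamMax M

/-- The multiplicity of the largest eigenvalue. -/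
def topMult (M : Matrix n n ℝ) : ℕ := (topIdx M).card

/-- `W = (1 / multiplicity) * ∑ vᵢ vᵢᵀ`, the sum being over the eigenvectors of the largest
eigenvalue. -/
def topAvg (M : Matrix n n ℝ) : Matrix n n ℝ :=
  (topMult M : ℝ)⁻¹ • ∑ i ∈ topIdx M, Matrix.vecMulVec (symEigVec M i) (symEigVec M i)

end Eigen

/-- The derivative of `s ↦ max(0, s) ^ p` (for `p = 1` the value at the kink `s = 0` is `0`). -/
def penaltyDeriv (p s : ℝ) : ℝ := if 0 < s then p * s ^ (p - 1) else 0

/-! ### Data of the funnel synthesis problem -/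

/-- `f` is measurable and bounded on `[a, b]` (in particular, every piecewise continuous `f`). -/
def BddMeasOn (a b : ℝ) (f : ℝ → ℝ) : Prop :=
  AEMeasurable f (volume.restrict (Icc a b)) ∧ ∃ R : ℝ, ∀ t ∈ Icc a b, |f t| ≤ R

/-- The class of nonlinearities, which determines the set of admissible multiplier pairs.
* `sector S₁ S₂`: pairs `(lam S₁, lam S₂)` with `lam ≥ 0` (a sector bound with weight `S` has
  `S₁ = S₂ = S`).
* `lipschitz`: channels `1, …, nc`; `cq`, `cp` give the channel of each component of `δq`, `δp`,
  and `γ` the channelwise bounds on the variation of the Jacobian.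
* `lSmooth`: as before, with smoothness constants `β` and fixed constants `lam`; the bounds
  `s` on the squared norms of the channels of `δq` are further decision variables.
* `convexSet`: any other parametrisation by closed convex sets. -/
inductive MultiplierClass (nq np : ℕ) where
  | sector (S₁ : Matrix (Fin nq) (Fin nq) ℝ) (S₂ : Matrix (Fin np) (Fin np) ℝ)
  | lipschitz (nc : ℕ) (cq : Fin nq → Fin nc) (cp : Fin np → Fin nc) (γ : ℝ → Fin nc → ℝ)
  | lSmooth (nc : ℕ) (cq : Fin nq → Fin nc) (cp : Fin np → Fin nc) (β : ℝ → Fin nc → ℝ)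
      (lam : Fin nc → ℝ≥0)
  | convexSet (𝒩 : ℝ → Set (Matrix (Fin nq) (Fin nq) ℝ × Matrix (Fin np) (Fin np) ℝ))
      (convex : ∀ t, Convex ℝ (𝒩 t)) (closed : ∀ t, IsClosed (𝒩 t))

namespace MultiplierClass

variable {nq np : ℕ}

/-- The number of additional decision variables `sᵢ`. -/
def ns : MultiplierClass nq np → ℕ
  | sector _ _ => 0
  | lipschitz _ _ _ _ => 0
  | lSmooth nc _ _ _ _ => nc
  | convexSet _ _ _ => 0

/-- The components of `δq` that belong to the channel `i`, for the channels with a variable `sᵢ`. -/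
def rows : (m : MultiplierClass nq np) → Fin m.ns → Finset (Fin nq)
  | sector _ _ => fun _ => ∅
  | lipschitz _ _ _ _ => fun _ => ∅
  | lSmooth nc cq _ _ _ => fun (i : Fin nc) => Finset.univ.filter fun a => cq a = i
  | convexSet _ _ _ => fun _ => ∅

/-- The inclusion `(N₁, N₂) ∈ 𝒩(t)`, written in terms of `(N₁, N₂, s)`. -/
def Admissible : (m : MultiplierClass nq np) → ℝ → Matrix (Fin nq) (Fin nq) ℝ →
    Matrix (Fin np) (Fin np) ℝ → (Fin m.ns → ℝ) → Prop
  | sector S₁ S₂ => fun _ N₁ N₂ _ => ∃ lam : ℝ, 0 ≤ lam ∧ N₁ = lam • S₁ ∧ N₂ = lam • S₂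
  | lipschitz nc cq cp γ => fun t N₁ N₂ _ => ∃ lam : Fin nc → ℝ, (∀ i, 0 ≤ lam i) ∧
      N₁ = Matrix.diagonal (fun a => lam (cq a)) ∧
      N₂ = Matrix.diagonal (fun b => lam (cp b) * γ t (cp b) ^ 2)
  | lSmooth nc cq cp β lam => fun t N₁ N₂ (s : Fin nc → ℝ) => (∀ i, 0 ≤ s i) ∧
      N₁ = Matrix.diagonal (fun a => (lam (cq a) : ℝ)) ∧
      N₂ = Matrix.diagonal (fun b => (lam (cp b) : ℝ) * s (cp b) * β t (cp b) ^ 2)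
  | convexSet 𝒩 _ _ => fun t N₁ N₂ _ => (N₁, N₂) ∈ 𝒩 t

end MultiplierClass

/-- The two forms of the funnel dynamics: `Q̇ = H₁₁ + H₁₁ᵀ + Z` and `Q̇ = Z`. -/
inductive FunnelDynamics where
  | lyapunov
  | direct

/-- Data of the discretized funnel synthesis problem around a nominal trajectory
`(xbar, ubar)`, with incremental system
`η̇ = A η + B ξ + F w + E δp`, `δq = C η + D ξ + G w`. -/
structure FunnelProblem where
  /-- dimensions of state, input, disturbance, `δq`, `δp` -/
  (nx nu nw nq np : ℕ)
  /-- numbers of state and input constraints -/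
  (mx mu : ℕ)
  /-- number of subintervals of the time grid -/
  N : ℕ
  N_pos : 0 < N
  (t0 tf : ℝ)
  t0_lt_tf : t0 < tf
  A : ℝ → Matrix (Fin nx) (Fin nx) ℝ
  B : ℝ → Matrix (Fin nx) (Fin nu) ℝ
  F : ℝ → Matrix (Fin nx) (Fin nw) ℝ
  E : Matrix (Fin nx) (Fin np) ℝ
  C : Matrix (Fin nq) (Fin nx) ℝ
  D : Matrix (Fin nq) (Fin nu) ℝ
  G : Matrix (Fin nq) (Fin nw) ℝ
  /-- the transformation of the block-diagonal multiplier parametrisation -/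
  T : ℝ → Matrix (Fin nq ⊕ Fin np) (Fin nq ⊕ Fin np) ℝ
  mult : MultiplierClass nq np
  /-- decay rate -/
  α : ℝ
  α_nonneg : 0 ≤ α
  /-- support value of the funnel -/
  cQ : ℝ
  cQ_nonneg : 0 ≤ cQ
  xbar : ℝ → Fin nx → ℝ
  ubar : ℝ → Fin nu → ℝ
  /-- state constraints `(ahᵢ(t))ᵀ x ≤ bhᵢ(t)` -/
  ah : Fin mx → ℝ → Fin nx → ℝ
  bh : Fin mx → ℝ → ℝ
  /-- input constraints `(agⱼ(t))ᵀ u ≤ bgⱼ(t)` -/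
  ag : Fin mu → ℝ → Fin nu → ℝ
  bg : Fin mu → ℝ → ℝ
  /-- bound on the terminal funnel -/
  Qf : Matrix (Fin nx) (Fin nx) ℝ
  Qf_posDef : Qf.PosDef
  dyn : FunnelDynamics
  /-- the cost `J`, a closed convex function with effective domain `domJ` -/
  J : Matrix (Fin nx) (Fin nx) ℝ → ℝ
  domJ : Set (Matrix (Fin nx) (Fin nx) ℝ)
  posDef_mem_domJ : ∀ Q : Matrix (Fin nx) (Fin nx) ℝ, Q.PosDef → Q ∈ domJ
  convex_J : ConvexOn ℝ domJ J
  closed_J : ∀ c : ℝ, IsClosed {Q | Q ∈ domJ ∧ J Q ≤ c}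
  /-- penalty exponents for the invariance LMI, the state LMIs, the input LMIs and the
  LMIs for the variables `sᵢ` -/
  p : Unit ⊕ Fin mx ⊕ Fin mu ⊕ Fin mult.ns → ℝ
  one_le_p : ∀ l, 1 ≤ p l
  /-- relaxation of the continuous-time constraints -/
  ε : ℝ
  ε_pos : 0 < ε
  T_nonsing : ∀ t ∈ Icc t0 tf, IsUnit (T t).det
  T22_nonsing : ∀ t ∈ Icc t0 tf, IsUnit (T t).toBlocks₂₂.det
  A_reg : ∀ i j, BddMeasOn t0 tf fun t => A t i j
  B_reg : ∀ i j, BddMeasOn t0 tf fun t => B t i j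
  F_reg : ∀ i j, BddMeasOn t0 tf fun t => F t i j
  T_reg : ∀ i j, BddMeasOn t0 tf fun t => T t i j
  T22_inv_reg : ∀ i j, BddMeasOn t0 tf fun t => (T t).toBlocks₂₂⁻¹ i j
  xbar_reg : ∀ i, BddMeasOn t0 tf fun t => xbar t i
  ubar_reg : ∀ i, BddMeasOn t0 tf fun t => ubar t i
  ah_reg : ∀ k i, BddMeasOn t0 tf fun t => ah k t i
  bh_reg : ∀ k, BddMeasOn t0 tf (bh k)
  ag_reg : ∀ k i, BddMeasOn t0 tf fun t => ag k t i
  bg_reg : ∀ k, BddMeasOn t0 tf (bg k)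

namespace FunnelProblem

variable (P : FunnelProblem)

/-! ### Decision variables -/

/-- Coordinates of `ζ = (Y, Z, N₁, N₂, λ_w, s)`. -/
abbrev ZIdx : Type :=
  (Fin P.nu × Fin P.nx) ⊕ (Fin P.nx × Fin P.nx) ⊕ (Fin P.nq × Fin P.nq) ⊕
    (Fin P.np × Fin P.np) ⊕ Unit ⊕ Fin P.mult.ns

/-- Vectorized `Q`. -/
abbrev QVec : Type := EuclideanSpace ℝ (Fin P.nx × Fin P.nx)

/-- Vectorized `ζ`. -/
abbrev Zeta : Type := EuclideanSpace ℝ P.ZIdx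

/-- The variables `χ_k = (Q_k, ζ_k^m, ζ_{k+1}^p)` of one subinterval, with the Euclidean norm of
the vectorization. -/
abbrev Chi : Type := EuclideanSpace ℝ ((Fin P.nx × Fin P.nx) ⊕ P.ZIdx ⊕ P.ZIdx)

/-- All decision variables: `χ_0, …, χ_{N-1}` and `Q_N`. -/
abbrev Dec : Type := (Fin P.N → P.Chi) × P.QVec

variable {P}

/-- The matrix with vectorization `q`. -/
def mat (q : P.QVec) : Matrix (Fin P.nx) (Fin P.nx) ℝ := Matrix.of fun i j => q (i, j)

namespace Zeta

def Y (ζ : P.Zeta) : Matrix (Fin P.nu) (Fin P.nx) ℝ := Matrix.of fun i j => ζ (.inl (i, j))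

def Z (ζ : P.Zeta) : Matrix (Fin P.nx) (Fin P.nx) ℝ := Matrix.of fun i j => ζ (.inr (.inl (i, j)))

def N₁ (ζ : P.Zeta) : Matrix (Fin P.nq) (Fin P.nq) ℝ :=
  Matrix.of fun i j => ζ (.inr (.inr (.inl (i, j))))

def N₂ (ζ : P.Zeta) : Matrix (Fin P.np) (Fin P.np) ℝ :=
  Matrix.of fun i j => ζ (.inr (.inr (.inr (.inl (i, j)))))

def lamW (ζ : P.Zeta) : ℝ := ζ (.inr (.inr (.inr (.inr (.inl ())))))

def s (ζ : P.Zeta) : Fin P.mult.ns → ℝ := fun i => ζ (.inr (.inr (.inr (.inr (.inr i)))))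

end Zeta

namespace Chi

def q (χ : P.Chi) : P.QVec := WithLp.toLp 2 fun a => χ (.inl a)

def ζm (χ : P.Chi) : P.Zeta := WithLp.toLp 2 fun a => χ (.inr (.inl a))

def ζp (χ : P.Chi) : P.Zeta := WithLp.toLp 2 fun a => χ (.inr (.inr a))

end Chi

variable (P)

/-! ### The matrix inequalities -/

def T11 (t : ℝ) : Matrix (Fin P.nq) (Fin P.nq) ℝ := (P.T t).toBlocks₁₁
def T12 (t : ℝ) : Matrix (Fin P.nq) (Fin P.np) ℝ := (P.T t).toBlocks₁₂
def T21 (t : ℝ) : Matrix (Fin P.np) (Fin P.nq) ℝ := (P.T t).toBlocks₂₁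
def T22 (t : ℝ) : Matrix (Fin P.np) (Fin P.np) ℝ := (P.T t).toBlocks₂₂

def Lam (t : ℝ) : Matrix (Fin P.nq) (Fin P.np) ℝ := P.T12 t * (P.T22 t)⁻¹

def Sig (t : ℝ) : Matrix (Fin P.nq) (Fin P.nq) ℝ := P.T11 t - P.T12 t * (P.T22 t)⁻¹ * P.T21 t

def H11 (t : ℝ) (Q : Matrix (Fin P.nx) (Fin P.nx) ℝ) (Y : Matrix (Fin P.nu) (Fin P.nx) ℝ) :
    Matrix (Fin P.nx) (Fin P.nx) ℝ :=
  P.A t * Q + P.B t * Y - P.E * (P.T22 t)⁻¹ * P.T21 t * (P.C * Q + P.D * Y) + (P.α / 2) • Q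

def H12 (t : ℝ) (Q : Matrix (Fin P.nx) (Fin P.nx) ℝ) (ζ : P.Zeta) :
    Matrix (Fin P.np ⊕ (Fin P.nw ⊕ Fin P.nq)) (Fin P.nx) ℝ :=
  Matrix.fromRows (ζ.N₂ * (P.T22 t)⁻¹.transpose * P.E.transpose)
    (Matrix.fromRows
      ((P.F t).transpose
        - P.G.transpose * (P.T21 t).transpose * (P.T22 t)⁻¹.transpose * P.E.transpose)
      (P.Sig t * (P.C * Q + P.D * ζ.Y)))

def H22 (t : ℝ) (ζ : P.Zeta) :
    Matrix (Fin P.np ⊕ (Fin P.nw ⊕ Fin P.nq)) (Fin P.np ⊕ (Fin P.nw ⊕ Fin P.nq)) ℝ :=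
  Matrix.fromBlocks
    (-ζ.N₂) (Matrix.fromCols 0 (P.Lam t * ζ.N₂).transpose)
    (Matrix.fromRows 0 (P.Lam t * ζ.N₂))
    (Matrix.fromBlocks
      (-(ζ.lamW • (1 : Matrix (Fin P.nw) (Fin P.nw) ℝ))) (P.Sig t * P.G).transpose
      (P.Sig t * P.G) (-ζ.N₁))

/-- The right-hand side of the funnel dynamics. -/
def dynRHS (t : ℝ) (Q : Matrix (Fin P.nx) (Fin P.nx) ℝ) (ζ : P.Zeta) :
    Matrix (Fin P.nx) (Fin P.nx) ℝ :=
  match P.dyn with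
  | .lyapunov => P.H11 t Q ζ.Y + (P.H11 t Q ζ.Y).transpose + ζ.Z
  | .direct => ζ.Z

/-- The upper left block of the invariance condition. -/
def invBlock (t : ℝ) (Q : Matrix (Fin P.nx) (Fin P.nx) ℝ) (ζ : P.Zeta) :
    Matrix (Fin P.nx) (Fin P.nx) ℝ :=
  match P.dyn with
  | .lyapunov => -ζ.Z
  | .direct => P.H11 t Q ζ.Y + (P.H11 t Q ζ.Y).transpose - ζ.Z

/-- The labels of the LMIs: invariance, state constraints, input constraints, variables `sᵢ`. -/
abbrev LIdx : Type := Unit ⊕ Fin P.mx ⊕ Fin P.mu ⊕ Fin P.mult.ns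

/-- The index type of the rows and columns of the LMI with label `l`. -/
def Blk : P.LIdx → Type
  | .inl _ => Fin P.nx ⊕ (Fin P.np ⊕ (Fin P.nw ⊕ Fin P.nq))
  | .inr (.inl _) => Unit ⊕ Fin P.nx
  | .inr (.inr (.inl _)) => Unit ⊕ Fin P.nx
  | .inr (.inr (.inr i)) => {a : Fin P.nq // a ∈ P.mult.rows i} ⊕ Fin P.nx

instance instFintypeBlk : (l : P.LIdx) → Fintype (P.Blk l)
  | .inl _ => inferInstanceAs (Fintype (Fin P.nx ⊕ (Fin P.np ⊕ (Fin P.nw ⊕ Fin P.nq))))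
  | .inr (.inl _) => inferInstanceAs (Fintype (Unit ⊕ Fin P.nx))
  | .inr (.inr (.inl _)) => inferInstanceAs (Fintype (Unit ⊕ Fin P.nx))
  | .inr (.inr (.inr i)) =>
      inferInstanceAs (Fintype ({a : Fin P.nq // a ∈ P.mult.rows i} ⊕ Fin P.nx))

instance instDecidableEqBlk : (l : P.LIdx) → DecidableEq (P.Blk l)
  | .inl _ => inferInstanceAs (DecidableEq (Fin P.nx ⊕ (Fin P.np ⊕ (Fin P.nw ⊕ Fin P.nq))))
  | .inr (.inl _) => inferInstanceAs (DecidableEq (Unit ⊕ Fin P.nx))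
  | .inr (.inr (.inl _)) => inferInstanceAs (DecidableEq (Unit ⊕ Fin P.nx))
  | .inr (.inr (.inr i)) =>
      inferInstanceAs (DecidableEq ({a : Fin P.nq // a ∈ P.mult.rows i} ⊕ Fin P.nx))

/-- The left-hand side of the LMI `L_l(t, Q, ζ) ⪯ 0`. -/
def LMI : (l : P.LIdx) → ℝ → Matrix (Fin P.nx) (Fin P.nx) ℝ → P.Zeta →
    Matrix (P.Blk l) (P.Blk l) ℝ
  | .inl _ => fun t Q ζ =>
      Matrix.fromBlocks (P.invBlock t Q ζ) (P.H12 t Q ζ).transpose (P.H12 t Q ζ) (P.H22 t ζ)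
  | .inr (.inl i) => fun t Q _ =>
      -Matrix.fromBlocks
        (Matrix.of fun (_ _ : Unit) => (P.bh i t - P.ah i t ⬝ᵥ P.xbar t) ^ 2)
        (Matrix.replicateRow Unit (P.cQ • Matrix.vecMul (P.ah i t) Q))
        (Matrix.replicateCol Unit (P.cQ • Q.mulVec (P.ah i t)))
        (P.cQ • Q)
  | .inr (.inr (.inl j)) => fun t Q ζ =>
      -Matrix.fromBlocks
        (Matrix.of fun (_ _ : Unit) => (P.bg j t - P.ag j t ⬝ᵥ P.ubar t) ^ 2)
        (Matrix.replicateRow Unit (P.cQ • Matrix.vecMul (P.ag j t) ζ.Y))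
        (Matrix.replicateCol Unit (P.cQ • ζ.Y.transpose.mulVec (P.ag j t)))
        (P.cQ • Q)
  | .inr (.inr (.inr i)) => fun _ Q ζ =>
      -Matrix.fromBlocks
        (ζ.s i • (1 : Matrix {a : Fin P.nq // a ∈ P.mult.rows i} {a // a ∈ P.mult.rows i} ℝ))
        ((P.C * Q + P.D * ζ.Y).submatrix Subtype.val id)
        ((P.C * Q + P.D * ζ.Y).submatrix Subtype.val id).transpose
        Q

/-! ### Discretization -/

/-- The uniform grid `t_k = t_0 + (k / N) (t_f - t_0)`. -/
def node (k : ℕ) : ℝ := P.t0 + (k : ℝ) / (P.N : ℝ) * (P.tf - P.t0)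

/-- First-order hold of `ζ` on `[t_k, t_{k+1}]`. -/
def foh (k : ℕ) (χ : P.Chi) (t : ℝ) : P.Zeta :=
  ((P.node (k + 1) - t) / (P.node (k + 1) - P.node k)) • χ.ζm
    + ((t - P.node k) / (P.node (k + 1) - P.node k)) • χ.ζp

/-- `Q` solves the funnel dynamics on `[t_k, t_{k+1}]` from `Q(t_k) = Q_k` (in integrated form). -/
def IsFunnelPath (k : ℕ) (χ : P.Chi) (Q : ℝ → Matrix (Fin P.nx) (Fin P.nx) ℝ) : Prop :=
  ContinuousOn Q (Icc (P.node k) (P.node (k + 1))) ∧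
    ∀ t ∈ Icc (P.node k) (P.node (k + 1)), ∀ i j,
      Q t i j = mat χ.q i j + ∫ τ in (P.node k)..t, P.dynRHS τ (Q τ) (P.foh k χ τ) i j

/-- The solution `Q(t)`, `t ∈ [t_k, t_{k+1}]`, of this linear equation. -/
def path (k : ℕ) (χ : P.Chi) : ℝ → Matrix (Fin P.nx) (Fin P.nx) ℝ :=
  Classical.epsilon (P.IsFunnelPath k χ)

/-- `L_l(t, χ_k) = L_l(t, Q(t), ζ(t))` for `t ∈ [t_k, t_{k+1}]`. -/
def LChi (k : ℕ) (l : P.LIdx) (t : ℝ) (χ : P.Chi) : Matrix (P.Blk l) (P.Blk l) ℝ :=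
  P.LMI l t (P.path k χ t) (P.foh k χ t)

/-- `h_k^l(χ_k) = ∫ max(0, λ_max(L_l(t, χ_k))) ^ p_l dt` over `[t_k, t_{k+1}]`. -/
def h (k : ℕ) (l : P.LIdx) (χ : P.Chi) : ℝ :=
  ∫ t in (P.node k)..(P.node (k + 1)), max 0 (lamMax (P.LChi k l t χ)) ^ P.p l

/-- The chosen subgradient of the integrand:
`∂ max(0, λ_max) ^ p_l / ∂ λ_max * (∂ vec L_l / ∂ χ_k) vec W`. -/
def gInt (k : ℕ) (l : P.LIdx) (t : ℝ) (χ : P.Chi) : P.Chi :=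
  penaltyDeriv (P.p l) (lamMax (P.LChi k l t χ)) •
    ∑ i, ∑ j, topAvg (P.LChi k l t χ) i j • ∇ (fun ξ : P.Chi => P.LChi k l t ξ i j) χ

/-- The chosen subgradient `g_k^l` of `h_k^l`. -/
def g (k : ℕ) (l : P.LIdx) (χ : P.Chi) : P.Chi :=
  ∫ t in (P.node k)..(P.node (k + 1)), P.gInt k l t χ

/-! ### The optimization problems -/

/-- The node value `Q_k`, `0 ≤ k ≤ N`. -/
def Qnode (z : P.Dec) (k : ℕ) : Matrix (Fin P.nx) (Fin P.nx) ℝ :=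
  if hk : k < P.N then mat (Chi.q (z.1 ⟨k, hk⟩)) else mat z.2

/-- The constraints on `(Q, ζ)` at the time `t`: symmetry of the matrix variables, the LMIs,
the multiplier inclusion and the bounds `0 ≤ λ_w ≤ α`. -/
def NodeFeasible (t : ℝ) (Q : Matrix (Fin P.nx) (Fin P.nx) ℝ) (ζ : P.Zeta) : Prop :=
  Q.IsSymm ∧ ζ.Z.IsSymm ∧ ζ.N₁.IsSymm ∧ ζ.N₂.IsSymm ∧
    (∀ l, (-P.LMI l t Q ζ).PosSemidef) ∧
    P.mult.Admissible t ζ.N₁ ζ.N₂ ζ.s ∧ 0 ≤ ζ.lamW ∧ ζ.lamW ≤ P.α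

/-- The constraints of the discrete funnel synthesis problem: discretized funnel dynamics,
nodal constraints on both sides of each node, terminal constraint, and `Q_0 ∈ domJ`. -/
def BaseFeasible (z : P.Dec) : Prop :=
  (∀ k : Fin P.N, P.Qnode z (k + 1) = P.path k (z.1 k) (P.node (k + 1))) ∧
    (∀ k : Fin P.N, P.NodeFeasible (P.node k) (P.Qnode z k) (Chi.ζm (z.1 k))) ∧
    (∀ k : Fin P.N, P.NodeFeasible (P.node (k + 1)) (P.Qnode z (k + 1)) (Chi.ζp (z.1 k))) ∧
    (P.Qf - P.Qnode z P.N).PosSemidef ∧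
    P.Qnode z 0 ∈ P.domJ

/-- Feasibility for the problem with the `ε`-relaxed continuous-time constraints. -/
def MainFeasible (z : P.Dec) : Prop :=
  P.BaseFeasible z ∧ ∀ (k : Fin P.N) (l : P.LIdx), P.h k l (z.1 k) ≤ P.ε

/-- Solutions (global minimizers) of the problem with the `ε`-relaxed continuous-time
constraints. -/
def IsSolution (z : P.Dec) : Prop :=
  P.MainFeasible z ∧ ∀ y, P.MainFeasible y → P.J (P.Qnode z 0) ≤ P.J (P.Qnode y 0)

/-- The linearized constraint violation `v_k^l` at `z` with reference point `zb`. -/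
def linViol (zb z : P.Dec) (k : Fin P.N) (l : P.LIdx) : ℝ :=
  P.h k l (zb.1 k) + inner ℝ (P.g k l (zb.1 k)) (z.1 k - zb.1 k) - P.ε

/-- The objective of the SDP subproblem with reference point `zb`. -/
def subObj (wh wtr : ℝ) (zb z : P.Dec) : ℝ :=
  P.J (P.Qnode z 0) + wh * ∑ k : Fin P.N, ∑ l : P.LIdx, max 0 (P.linViol zb z k l)
    + wtr * (∑ k : Fin P.N, ‖z.1 k - zb.1 k‖ ^ 2 + ‖z.2 - zb.2‖ ^ 2)

/-- `z` solves the SDP subproblem with reference point `zb`. -/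
def IsSubSolution (wh wtr : ℝ) (zb z : P.Dec) : Prop :=
  P.BaseFeasible z ∧ ∀ y, P.BaseFeasible y → P.subObj wh wtr zb z ≤ P.subObj wh wtr zb y

/-- A sequence generated by the SCvx method with weights `wh`, `wtr` from the initial guess
`z 0`. -/
def IsSCvxSequence (wh wtr : ℝ) (z : ℕ → P.Dec) : Prop :=
  ∀ i, P.IsSubSolution wh wtr (z i) (z (i + 1))

end FunnelProblem

end

/-!
The penalized problem `min J + wh * violation` over the base-feasible set is convex, and every step
of the SCvx method between feasible points is a proximal step for it in the sense of the
three-point inequality `penObj_add_sqDist_le`. The convergence statements are drawn from that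
inequality.

*The subgradients.* For a nonempty index type, the averaged top eigenprojection `topAvg M` is
positive semidefinite with trace one and pairs with `M` to `lamMax M`, hence is a subgradient of
`lamMax`, whatever the multiplicity (`lamMax_add_frobPair_le`). The funnel path is the unique
solution of a linear equation with bounded measurable coefficients (`exists_isIntegralSolution`,
`IsIntegralSolution.eqOn`), so it is linear in `χ` (`path_comb`) and the matrix inequalities are
affine in `χ` with bounded measurable coefficients in time. Since `topAvg` is also a measurable
function of the matrix (`aemeasurable_topAvg`: it is a normalized limit of powers of a continuous
matrix function), the subgradient inequality may be integrated: `g` is a subgradient of the convex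
function `h` at every point (`h_add_inner_g_le`). Where the largest eigenvalue is almost everywhere
simple, it has a first-order expansion (`exists_abs_lamMax_sub_frobPair_le`), and differentiation
under the integral gives the gradient of `h` for exponents larger than one (`hasGradientAt_h`).

*The proximal step.* If `g` is `β`-Lipschitz on the convex feasible set, the subgradient
inequalities along a partition of a segment give the descent inequality without differentiability
of `h` (`le_add_inner_add_of_subgradient`). With `wh * ∑ β ≤ 2 * wtr` the objective of the
subproblem is therefore a majorant of the penalty function (`penObj_le_subObj`). Strong convexity
of the subproblem and `linViol ≤ h - ε` complete the three-point inequality.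

*Convergence.* By the three-point inequality the penalty values tend to the infimum, so every
cluster point minimizes the penalty function by lower semicontinuity of `J`; if it is feasible, it
solves the constrained problem. The distance to any minimizer is nonincreasing, so the existence of
one forces convergence (`IsProximalSequence.exists_tendsto`). A strictly feasible point yields a
threshold beyond which the solutions are minimizers of the penalty function, and conversely
(`exists_exact_penalty`, `isSolution_of_penObj_le`).
-/

open scoped Matrix

noncomputable section

/-! ### Spectral theory of the symmetric part -/

section SymmetricPart

variable {n : Type*} [Fintype n] [DecidableEq n]

theorem symEigVec_dotProduct (M : Matrix n n ℝ) (i j : n) :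
    symEigVec M i ⬝ᵥ symEigVec M j = if i = j then 1 else 0 := by
  have h := (isHermitian_symPart M).eigenvectorBasis.inner_eq_ite j i
  rw [EuclideanSpace.inner_eq_star_dotProduct] at h
  simpa [symEigVec, eq_comm] using h

theorem sum_symEigVec_mul (M : Matrix n n ℝ) (a b : n) :
    ∑ i, symEigVec M i a * symEigVec M i b = if a = b then 1 else 0 := by
  let U : Matrix n n ℝ := Matrix.of fun i a => symEigVec M i a
  have h : U * U.transpose = 1 := by
    ext i j
    have := symEigVec_dotProduct M i j
    simpa [U, Matrix.mul_apply, dotProduct, Matrix.one_apply] using this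
  have h' := congrArg (fun X : Matrix n n ℝ => X a b) (mul_eq_one_comm.mp h)
  simpa [U, Matrix.mul_apply, Matrix.one_apply] using h'

theorem symPart_mulVec_symEigVec (M : Matrix n n ℝ) (i : n) :
    symPart M *ᵥ symEigVec M i = symEig M i • symEigVec M i :=
  (isHermitian_symPart M).mulVec_eigenvectorBasis i

omit [DecidableEq n] in
theorem dotProduct_symPart_mulVec (M : Matrix n n ℝ) (x : n → ℝ) :
    x ⬝ᵥ symPart M *ᵥ x = x ⬝ᵥ M *ᵥ x := by
  have : x ⬝ᵥ M.transpose *ᵥ x = x ⬝ᵥ M *ᵥ x := by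
    rw [Matrix.mulVec_transpose, dotProduct_comm, Matrix.dotProduct_mulVec]
  simp only [symPart, Matrix.smul_mulVec, Matrix.add_mulVec, dotProduct_smul, dotProduct_add,
    this, smul_eq_mul]
  ring

theorem dotProduct_mulVec_symEigVec (M : Matrix n n ℝ) (i : n) :
    symEigVec M i ⬝ᵥ M *ᵥ symEigVec M i = symEig M i := by
  rw [← dotProduct_symPart_mulVec, symPart_mulVec_symEigVec, dotProduct_smul,
    symEigVec_dotProduct]
  simp

theorem sum_dotProduct_symEigVec_smul (M : Matrix n n ℝ) (x : n → ℝ) :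
    ∑ i, (symEigVec M i ⬝ᵥ x) • symEigVec M i = x := by
  ext a
  simp only [Finset.sum_apply, Pi.smul_apply, smul_eq_mul, dotProduct, Finset.sum_mul]
  rw [Finset.sum_comm]
  have : ∀ b, ∑ i, symEigVec M i b * x b * symEigVec M i a = if b = a then x b else 0 := by
    intro b
    rw [← mul_one (x b), ← mul_zero (x b), ← mul_ite, mul_one, ← sum_symEigVec_mul M b a,
      Finset.mul_sum]
    exact Finset.sum_congr rfl fun i _ => by ring
  simp [this]

theorem sum_sq_dotProduct_symEigVec (M : Matrix n n ℝ) (x : n → ℝ) :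
    ∑ i, (symEigVec M i ⬝ᵥ x) ^ 2 = x ⬝ᵥ x := by
  conv_rhs => rw [← sum_dotProduct_symEigVec_smul M x]
  rw [sum_dotProduct]
  refine Finset.sum_congr rfl fun i _ => ?_
  rw [sum_dotProduct_symEigVec_smul, smul_dotProduct, smul_eq_mul, sq]

theorem dotProduct_mulVec_eq_sum_symEig (M : Matrix n n ℝ) (x : n → ℝ) :
    x ⬝ᵥ M *ᵥ x = ∑ i, symEig M i * (symEigVec M i ⬝ᵥ x) ^ 2 := by
  rw [← dotProduct_symPart_mulVec]
  conv_lhs => rw [← sum_dotProduct_symEigVec_smul M x]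
  simp only [Matrix.mulVec_sum, Matrix.mulVec_smul, symPart_mulVec_symEigVec]
  rw [sum_dotProduct_symEigVec_smul, dotProduct_sum]
  refine Finset.sum_congr rfl fun i _ => ?_
  rw [dotProduct_smul, dotProduct_smul, dotProduct_comm x, smul_eq_mul, smul_eq_mul]
  ring

theorem symEig_le_lamMax (M : Matrix n n ℝ) (i : n) : symEig M i ≤ lamMax M :=
  le_ciSup (Set.finite_range _).bddAbove i

theorem exists_symEig_eq_lamMax [Nonempty n] (M : Matrix n n ℝ) : ∃ i, symEig M i = lamMax M :=
  exists_eq_ciSup_of_finite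

theorem dotProduct_mulVec_le_lamMax (M : Matrix n n ℝ) (x : n → ℝ) :
    x ⬝ᵥ M *ᵥ x ≤ lamMax M * (x ⬝ᵥ x) := by
  rw [dotProduct_mulVec_eq_sum_symEig, ← sum_sq_dotProduct_symEigVec M x, Finset.mul_sum]
  exact Finset.sum_le_sum fun i _ =>
    mul_le_mul_of_nonneg_right (symEig_le_lamMax M i) (sq_nonneg _)

omit [DecidableEq n] in
theorem abs_le_one_of_dotProduct_self_le_one {x : n → ℝ} (hx : x ⬝ᵥ x ≤ 1) (a : n) :
    |x a| ≤ 1 := by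
  rw [← sq_le_one_iff_abs_le_one]
  refine le_trans ?_ hx
  rw [sq]
  exact Finset.single_le_sum (f := fun a => x a * x a) (fun b _ => mul_self_nonneg _)
    (Finset.mem_univ a)

/-- The entrywise `ℓ¹` norm of a matrix. -/
def entrySum (M : Matrix n n ℝ) : ℝ := ∑ i, ∑ j, |M i j|

/-- The Frobenius pairing of two matrices. -/
def frobPair (W M : Matrix n n ℝ) : ℝ := ∑ i, ∑ j, W i j * M i j

omit [DecidableEq n] in
theorem frobPair_vecMulVec (x : n → ℝ) (M : Matrix n n ℝ) :
    frobPair (Matrix.vecMulVec x x) M = x ⬝ᵥ M *ᵥ x := by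
  simp only [frobPair, dotProduct, Matrix.mulVec, Matrix.vecMulVec_apply, Finset.mul_sum]
  exact Finset.sum_congr rfl fun i _ => Finset.sum_congr rfl fun j _ => by ring

omit [DecidableEq n] in
theorem entrySum_nonneg (M : Matrix n n ℝ) : 0 ≤ entrySum M :=
  Finset.sum_nonneg fun _ _ => Finset.sum_nonneg fun _ _ => abs_nonneg _

omit [DecidableEq n] in
theorem abs_frobPair_le {W : Matrix n n ℝ} {c : ℝ} (hW : ∀ i j, |W i j| ≤ c)
    (M : Matrix n n ℝ) : |frobPair W M| ≤ c * entrySum M := by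
  unfold frobPair entrySum
  rw [Finset.mul_sum]
  refine (Finset.abs_sum_le_sum_abs _ _).trans (Finset.sum_le_sum fun i _ => ?_)
  rw [Finset.mul_sum]
  refine (Finset.abs_sum_le_sum_abs _ _).trans (Finset.sum_le_sum fun j _ => ?_)
  rw [abs_mul]
  exact mul_le_mul_of_nonneg_right (hW i j) (abs_nonneg _)

omit [DecidableEq n] in
theorem frobPair_sub_right (W M M' : Matrix n n ℝ) :
    frobPair W (M - M') = frobPair W M - frobPair W M' := by
  simp [frobPair, mul_sub]

omit [DecidableEq n] in
theorem frobPair_sub_left (W W' M : Matrix n n ℝ) :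
    frobPair (W - W') M = frobPair W M - frobPair W' M := by
  simp [frobPair, sub_mul]

/-! ### The averaged top eigenprojection as a subgradient of the largest eigenvalue -/

theorem frobPair_topAvg (M M' : Matrix n n ℝ) :
    frobPair (topAvg M) M' =
      (topMult M : ℝ)⁻¹ * ∑ i ∈ topIdx M, symEigVec M i ⬝ᵥ M' *ᵥ symEigVec M i := by
  simp only [← frobPair_vecMulVec]
  simp only [frobPair, topAvg, Matrix.smul_apply, Matrix.sum_apply, smul_eq_mul, Finset.mul_sum,
    Finset.sum_mul]
  conv_rhs => rw [Finset.sum_comm]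
  refine Finset.sum_congr rfl fun i _ => ?_
  conv_rhs => rw [Finset.sum_comm]
  exact Finset.sum_congr rfl fun i _ => Finset.sum_congr rfl fun j _ => by ring

theorem topMult_pos [Nonempty n] (M : Matrix n n ℝ) : 0 < topMult M := by
  obtain ⟨i, hi⟩ := exists_symEig_eq_lamMax M
  exact Finset.card_pos.mpr ⟨i, by simp [topIdx, hi]⟩

theorem symEig_eq_of_mem_topIdx {M : Matrix n n ℝ} {i : n} (hi : i ∈ topIdx M) :
    symEig M i = lamMax M := by
  simpa [topIdx] using hi

theorem frobPair_topAvg_self [Nonempty n] (M : Matrix n n ℝ) :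
    frobPair (topAvg M) M = lamMax M := by
  rw [frobPair_topAvg, Finset.sum_congr rfl fun i hi => (dotProduct_mulVec_symEigVec M i).trans
    (symEig_eq_of_mem_topIdx hi), Finset.sum_const, nsmul_eq_mul, ← mul_assoc]
  change (topMult M : ℝ)⁻¹ * topMult M * _ = _
  rw [inv_mul_cancel₀ (Nat.cast_ne_zero.mpr (topMult_pos M).ne'), one_mul]

theorem frobPair_topAvg_le [Nonempty n] (M M' : Matrix n n ℝ) :
    frobPair (topAvg M) M' ≤ lamMax M' := by
  rw [frobPair_topAvg, inv_mul_le_iff₀ (Nat.cast_pos.mpr (topMult_pos M))]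
  refine (Finset.sum_le_card_nsmul _ _ (lamMax M') fun i _ => ?_).trans_eq (nsmul_eq_mul _ _)
  simpa [symEigVec_dotProduct] using dotProduct_mulVec_le_lamMax M' (symEigVec M i)

theorem abs_topAvg_le_one (M : Matrix n n ℝ) (a b : n) : |topAvg M a b| ≤ 1 := by
  simp only [topAvg, Matrix.smul_apply, Matrix.sum_apply, smul_eq_mul, abs_mul, abs_inv,
    Nat.abs_cast]
  refine inv_mul_le_one_of_le₀ ?_ (Nat.cast_nonneg _)
  refine (Finset.abs_sum_le_sum_abs _ _).trans ?_
  refine (Finset.sum_le_card_nsmul _ _ 1 fun i _ => ?_).trans_eq (by simp [topMult])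
  have h : ∀ c, |symEigVec M i c| ≤ 1 :=
    abs_le_one_of_dotProduct_self_le_one (by simp [symEigVec_dotProduct])
  rw [Matrix.vecMulVec_apply, abs_mul]
  exact mul_le_one₀ (h a) (abs_nonneg _) (h b)

/-- `topAvg M` is positive semidefinite with trace one and pairs with `M` to `lamMax M`, so it is
a subgradient of `lamMax` at `M`. For an empty index type, `lamMax` is the junk value `0` and the
inequality is trivial. -/
theorem lamMax_add_frobPair_le (M M' : Matrix n n ℝ) :
    lamMax M + frobPair (topAvg M) (M' - M) ≤ lamMax M' := by
  cases isEmpty_or_nonempty n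
  · simp [lamMax, frobPair]
  · rw [frobPair_sub_right, frobPair_topAvg_self]
    linarith [frobPair_topAvg_le M M']

theorem lamMax_sub_le (M M' : Matrix n n ℝ) : lamMax M - lamMax M' ≤ entrySum (M' - M) := by
  have h := lamMax_add_frobPair_le M M'
  have h' := (abs_le.mp (abs_frobPair_le (abs_topAvg_le_one M) (M' - M))).1
  linarith

theorem abs_lamMax_sub_le (M M' : Matrix n n ℝ) :
    |lamMax M' - lamMax M| ≤ entrySum (M' - M) := by
  rw [abs_sub_comm, abs_le]
  refine ⟨?_, lamMax_sub_le M M'⟩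
  have h : entrySum (M - M') = entrySum (M' - M) := by
    simp only [entrySum, Matrix.sub_apply, abs_sub_comm]
  linarith [lamMax_sub_le M' M]

omit [DecidableEq n] in
theorem continuous_entrySum : Continuous (entrySum : Matrix n n ℝ → ℝ) := by
  unfold entrySum
  fun_prop

theorem continuous_lamMax : Continuous (lamMax : Matrix n n ℝ → ℝ) := by
  refine continuous_iff_continuousAt.mpr fun M => ?_
  have h : Tendsto (fun M' => entrySum (M' - M)) (𝓝 M) (𝓝 0) := by
    have := ((continuous_entrySum (n := n)).comp (continuous_sub_right M)).tendsto M
    simpa [entrySum, Function.comp_def] using this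
  exact tendsto_iff_dist_tendsto_zero.mpr
    (squeeze_zero (fun _ => dist_nonneg) (fun M' => abs_lamMax_sub_le M M') h)

theorem lamMax_zero : lamMax (0 : Matrix n n ℝ) = 0 := by
  cases isEmpty_or_nonempty n
  · simp [lamMax]
  · rw [← frobPair_topAvg_self]
    simp [frobPair]

theorem abs_lamMax_le (M : Matrix n n ℝ) : |lamMax M| ≤ entrySum M := by
  simpa [lamMax_zero] using abs_lamMax_sub_le 0 M

/-! ### Measurability of the averaged top eigenprojection -/

/-- An upper bound for the spread of the eigenvalues of `M`, increased by one. -/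
def spread (M : Matrix n n ℝ) : ℝ := 1 + lamMax M + lamMax (-M)

/-- An affine function of the symmetric part of `M` with spectrum in `(0, 1]` whose eigenspace for
the eigenvalue `1` is the top eigenspace of `M`. Its powers converge to the projection onto that
eigenspace, which exhibits the latter as a limit of continuous functions of `M`. -/
def contrPart (M : Matrix n n ℝ) : Matrix n n ℝ :=
  1 - (spread M)⁻¹ • (lamMax M • (1 : Matrix n n ℝ) - symPart M)

theorem neg_lamMax_neg_le (M : Matrix n n ℝ) (i : n) : -lamMax (-M) ≤ symEig M i := by
  have h := dotProduct_mulVec_le_lamMax (-M) (symEigVec M i)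
  rw [Matrix.neg_mulVec, dotProduct_neg, dotProduct_mulVec_symEigVec, symEigVec_dotProduct] at h
  simp only [if_true, mul_one] at h
  linarith

theorem one_le_spread (M : Matrix n n ℝ) : 1 ≤ spread M := by
  unfold spread
  cases isEmpty_or_nonempty n
  · simp [lamMax]
  · obtain ⟨i, hi⟩ := exists_symEig_eq_lamMax M
    linarith [neg_lamMax_neg_le M i]

theorem contrPart_mulVec (M : Matrix n n ℝ) (i : n) :
    contrPart M *ᵥ symEigVec M i =
      (1 - (spread M)⁻¹ * (lamMax M - symEig M i)) • symEigVec M i := by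
  simp only [contrPart, Matrix.sub_mulVec, Matrix.smul_mulVec, Matrix.one_mulVec,
    symPart_mulVec_symEigVec, ← sub_smul, smul_smul]
  rw [sub_smul, one_smul]

theorem contrPart_pow (M : Matrix n n ℝ) (m : ℕ) :
    contrPart M ^ m = ∑ i, (1 - (spread M)⁻¹ * (lamMax M - symEig M i)) ^ m •
      Matrix.vecMulVec (symEigVec M i) (symEigVec M i) := by
  induction m with
  | zero =>
    ext a b
    simpa [Matrix.sum_apply, Matrix.vecMulVec_apply, Matrix.one_apply] using
      (sum_symEigVec_mul M a b).symm
  | succ m ih =>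
    rw [pow_succ', ih, Finset.mul_sum]
    refine Finset.sum_congr rfl fun i _ => ?_
    rw [Matrix.mul_smul, Matrix.mul_vecMulVec, contrPart_mulVec, Matrix.smul_vecMulVec, smul_smul,
      pow_succ]

theorem tendsto_contrPart_pow (M : Matrix n n ℝ) :
    Tendsto (fun m : ℕ => contrPart M ^ m) atTop
      (𝓝 (∑ i ∈ topIdx M, Matrix.vecMulVec (symEigVec M i) (symEigVec M i))) := by
  simp only [contrPart_pow]
  have hr := one_le_spread M
  have : ∑ i ∈ topIdx M, Matrix.vecMulVec (symEigVec M i) (symEigVec M i) =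
      ∑ i, (if i ∈ topIdx M then (1 : ℝ) else 0) •
        Matrix.vecMulVec (symEigVec M i) (symEigVec M i) := by
    simp [ite_smul]
  rw [this]
  refine tendsto_finsetSum _ fun i _ => Tendsto.smul_const ?_ _
  split_ifs with hi
  · rw [symEig_eq_of_mem_topIdx hi, sub_self, mul_zero, sub_zero]
    exact (tendsto_const_nhds (x := (1 : ℝ))).congr fun m => (one_pow m).symm
  · have hlt : symEig M i < lamMax M :=
      lt_of_le_of_ne (symEig_le_lamMax M i) (by simpa [topIdx] using hi)
    have h1 := neg_lamMax_neg_le M i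
    have h2 : (spread M)⁻¹ * (lamMax M - symEig M i) < 1 := by
      rw [inv_mul_lt_iff₀ (by linarith), spread]
      linarith
    have h3 : 0 < (spread M)⁻¹ * (lamMax M - symEig M i) :=
      mul_pos (inv_pos.mpr (by linarith)) (by linarith)
    exact tendsto_pow_atTop_nhds_zero_of_lt_one (by linarith) (by linarith)

omit [Fintype n] [DecidableEq n] in
theorem continuous_symPart : Continuous (symPart : Matrix n n ℝ → Matrix n n ℝ) := by
  unfold symPart
  fun_prop

theorem continuous_contrPart : Continuous (contrPart : Matrix n n ℝ → Matrix n n ℝ) := by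
  unfold contrPart spread
  have h1 := continuous_lamMax (n := n)
  have h2 := continuous_symPart (n := n)
  have h3 : Continuous fun M : Matrix n n ℝ => (1 + lamMax M + lamMax (-M))⁻¹ := by
    refine Continuous.inv₀ (by fun_prop) fun M => ?_
    have := one_le_spread M
    unfold spread at this
    linarith
  fun_prop

theorem aemeasurable_continuous_matrix {α m : Type*} [Fintype m] [MeasurableSpace α]
    {μ : Measure α} {M : α → Matrix m m ℝ} (hM : ∀ i j, AEMeasurable (fun t => M t i j) μ)
    {f : Matrix m m ℝ → ℝ} (hf : Continuous f) : AEMeasurable (fun t => f (M t)) μ := by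
  have hM' : AEMeasurable (β := m → m → ℝ) M μ :=
    aemeasurable_pi_lambda _ fun i => aemeasurable_pi_lambda _ fun j => hM i j
  have hf' : Measurable (α := m → m → ℝ) f := Continuous.measurable (α := m → m → ℝ) hf
  exact hf'.comp_aemeasurable hM'

theorem aemeasurable_topAvg {α : Type*} [MeasurableSpace α] {μ : Measure α}
    {M : α → Matrix n n ℝ} (hM : ∀ i j, AEMeasurable (fun t => M t i j) μ) (a b : n) :
    AEMeasurable (fun t => topAvg (M t) a b) μ := by
  have hproj : ∀ a b, AEMeasurable (fun t => (∑ i ∈ topIdx (M t),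
      Matrix.vecMulVec (symEigVec (M t) i) (symEigVec (M t) i)) a b) μ := by
    intro a b
    refine aemeasurable_of_tendsto_metrizable_ae' (f := fun (m : ℕ) t => (contrPart (M t) ^ m) a b)
      (fun m => ?_) (ae_of_all _ fun t => ?_)
    · refine aemeasurable_continuous_matrix hM (f := fun X => (contrPart X ^ m) a b) ?_
      have := continuous_contrPart (n := n)
      exact (this.pow m).matrix_elem a b
    · exact ((continuous_apply b).comp (continuous_apply a)).continuousAt.tendsto.comp
        (tendsto_contrPart_pow (M t))
  -- The multiplicity is the trace of the projection.
  have hmult : AEMeasurable (fun t => (topMult (M t) : ℝ)) μ := by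
    have h : ∀ t, (topMult (M t) : ℝ) = ∑ a, (∑ i ∈ topIdx (M t),
        Matrix.vecMulVec (symEigVec (M t) i) (symEigVec (M t) i)) a a := by
      intro t
      simp only [Matrix.sum_apply, Matrix.vecMulVec_apply]
      rw [Finset.sum_comm]
      have : ∀ i ∈ topIdx (M t), ∑ a, symEigVec (M t) i a * symEigVec (M t) i a = 1 := by
        intro i _
        simpa [dotProduct] using symEigVec_dotProduct (M t) i i
      rw [Finset.sum_congr rfl this]
      simp [topMult]
    simp only [h]
    exact Finset.aemeasurable_fun_sum _ fun a _ => hproj a a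
  exact hmult.inv.mul (hproj a b)

/-! ### Differentiability of a simple largest eigenvalue -/

/-- The vectors on which the quadratic form of `M` nearly attains a simple largest eigenvalue are
nearly aligned with the eigenvector. -/
theorem one_sub_sq_le_of_topIdx_eq_singleton {M : Matrix n n ℝ} {i₀ : n}
    (htop : topIdx M = {i₀}) : ∃ δ : ℝ, 0 < δ ∧ ∀ u : n → ℝ, u ⬝ᵥ u = 1 →
      δ * (1 - (symEigVec M i₀ ⬝ᵥ u) ^ 2) ≤ lamMax M - u ⬝ᵥ M *ᵥ u := by
  have hi₀ : symEig M i₀ = lamMax M := symEig_eq_of_mem_topIdx (by simp [htop])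
  obtain ⟨δ, hδ, hgap⟩ : ∃ δ : ℝ, 0 < δ ∧ ∀ i, i ≠ i₀ → symEig M i ≤ lamMax M - δ := by
    by_cases hne : (Finset.univ.erase i₀).Nonempty
    · obtain ⟨j, hj, hjmin⟩ := Finset.exists_max_image _ (symEig M) hne
      have hj' : j ∉ topIdx M := by simpa [htop] using hj
      refine ⟨lamMax M - symEig M j, sub_pos.mpr (lt_of_le_of_ne (symEig_le_lamMax M j)
        (by simpa [topIdx] using hj')), fun i hi => ?_⟩
      linarith [hjmin i (by simp [hi])]
    · refine ⟨1, one_pos, fun i hi => absurd ⟨i, by simp [hi]⟩ hne⟩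
  refine ⟨δ, hδ, fun u hu => ?_⟩
  rw [dotProduct_mulVec_eq_sum_symEig]
  have hsum := sum_sq_dotProduct_symEigVec M u
  rw [hu] at hsum
  rw [← Finset.add_sum_erase _ _ (Finset.mem_univ i₀)] at hsum ⊢
  have h : ∑ i ∈ Finset.univ.erase i₀, symEig M i * (symEigVec M i ⬝ᵥ u) ^ 2 ≤
      ∑ i ∈ Finset.univ.erase i₀, (lamMax M - δ) * (symEigVec M i ⬝ᵥ u) ^ 2 :=
    Finset.sum_le_sum fun i hi =>
      mul_le_mul_of_nonneg_right (hgap i (Finset.ne_of_mem_erase hi)) (sq_nonneg _)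
  rw [← Finset.mul_sum] at h
  rw [hi₀]
  have h2 := eq_sub_of_add_eq' hsum
  rw [h2] at h
  nlinarith

omit [DecidableEq n] in
/-- For unit vectors, the entries of `u uᵀ - v vᵀ` are controlled by the angle between them. -/
theorem abs_mul_sub_mul_le_sqrt {u v : n → ℝ} (hu : u ⬝ᵥ u = 1) (hv : v ⬝ᵥ v = 1) (a b : n) :
    |u a * u b - v a * v b| ≤ √(2 * (1 - (v ⬝ᵥ u) ^ 2)) := by
  refine Real.abs_le_sqrt ?_
  have h1 : ∑ a, ∑ b, (u a * u b - v a * v b) ^ 2 = 2 * (1 - (v ⬝ᵥ u) ^ 2) := by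
    have h : ∀ a b, (u a * u b - v a * v b) ^ 2 =
        (u a * u a) * (u b * u b) + (v a * v a) * (v b * v b)
          - 2 * ((v a * u a) * (v b * u b)) := fun a b => by ring
    simp only [h, Finset.sum_sub_distrib, Finset.sum_add_distrib, ← Finset.mul_sum,
      ← Finset.sum_mul]
    simp only [dotProduct] at hu hv ⊢
    rw [hu, hv]
    ring
  rw [← h1]
  refine le_trans ?_ (Finset.single_le_sum (f := fun a => ∑ b, (u a * u b - v a * v b) ^ 2)
    (fun _ _ => Finset.sum_nonneg fun _ _ => sq_nonneg _) (Finset.mem_univ a))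
  exact Finset.single_le_sum (f := fun b => (u a * u b - v a * v b) ^ 2)
    (fun _ _ => sq_nonneg _) (Finset.mem_univ b)

/-- First-order expansion of a simple largest eigenvalue. -/
theorem exists_abs_lamMax_sub_frobPair_le {M : Matrix n n ℝ} (hM : topMult M = 1) :
    ∃ c : ℝ, ∀ M' : Matrix n n ℝ, |lamMax M' - lamMax M - frobPair (topAvg M) (M' - M)| ≤
      √(c * entrySum (M' - M)) * entrySum (M' - M) := by
  obtain ⟨i₀, htop⟩ := Finset.card_eq_one.mp hM
  have : Nonempty n := ⟨i₀⟩
  obtain ⟨δ, hδ, hgap⟩ := one_sub_sq_le_of_topIdx_eq_singleton htop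
  refine ⟨4 / δ, fun M' => ?_⟩
  have hW : topAvg M = Matrix.vecMulVec (symEigVec M i₀) (symEigVec M i₀) := by
    simp [topAvg, hM, htop]
  obtain ⟨j, hj⟩ := exists_symEig_eq_lamMax M'
  set u := symEigVec M' j with hu_def
  set v := symEigVec M i₀ with hv_def
  have hu : u ⬝ᵥ u = 1 := by simp [hu_def, symEigVec_dotProduct]
  have hv : v ⬝ᵥ v = 1 := by simp [hv_def, symEigVec_dotProduct]
  have hval : u ⬝ᵥ M' *ᵥ u = lamMax M' := by rw [hu_def, dotProduct_mulVec_symEigVec, hj]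
  have hH : frobPair (Matrix.vecMulVec u u) (M' - M) = lamMax M' - u ⬝ᵥ M *ᵥ u := by
    rw [frobPair_sub_right, frobPair_vecMulVec, frobPair_vecMulVec, hval]
  have habs : ∀ a b, |Matrix.vecMulVec u u a b| ≤ 1 := fun a b => by
    have h := abs_le_one_of_dotProduct_self_le_one hu.le
    rw [Matrix.vecMulVec_apply, abs_mul]
    exact mul_le_one₀ (h a) (abs_nonneg _) (h b)
  have h1 := (abs_le.mp (abs_frobPair_le habs (M' - M))).2
  have h2 := (abs_le.mp (abs_lamMax_sub_le M M')).1
  have h3 := hgap u hu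
  have hangle : 2 * (1 - (v ⬝ᵥ u) ^ 2) ≤ 4 / δ * entrySum (M' - M) := by
    rw [div_mul_eq_mul_div, le_div_iff₀ hδ]
    linarith
  have hlow := lamMax_add_frobPair_le M M'
  rw [abs_of_nonneg (by linarith)]
  have hdiff : lamMax M' - lamMax M - frobPair (topAvg M) (M' - M) ≤
      frobPair (Matrix.vecMulVec u u - Matrix.vecMulVec v v) (M' - M) := by
    rw [frobPair_sub_left, hH, hW]
    have := dotProduct_mulVec_le_lamMax M u
    rw [hu, mul_one] at this
    linarith
  refine hdiff.trans ((le_abs_self _).trans (abs_frobPair_le (fun a b => ?_) _))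
  rw [Matrix.sub_apply, Matrix.vecMulVec_apply, Matrix.vecMulVec_apply]
  exact (abs_mul_sub_mul_le_sqrt hu hv a b).trans (Real.sqrt_le_sqrt hangle)

end SymmetricPart

/-! ### Integral equations with a measurable right-hand side -/

section Caratheodory

variable {E : Type*} [NormedAddCommGroup E] [NormedSpace ℝ E]

/-- `u` solves `u' = v(t, u)`, `u(a) = x₀` on `[a, b]` in integrated form. -/
def IsIntegralSolution (v : ℝ → E → E) (a b : ℝ) (x₀ : E) (u : ℝ → E) : Prop :=
  ContinuousOn u (Icc a b) ∧ ∀ t ∈ Icc a b, u t = x₀ + ∫ τ in a..t, v τ (u τ)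

/-- The conditions of Carathéodory type on the right-hand side: Lipschitz in the state, and
integrable along continuous curves. -/
structure IsLipCaratheodory (v : ℝ → E → E) (a b K : ℝ) : Prop where
  nonneg : 0 ≤ K
  lip : ∀ t ∈ Icc a b, ∀ x y, ‖v t x - v t y‖ ≤ K * ‖x - y‖
  integrable : ∀ u : ℝ → E, ContinuousOn u (Icc a b) → IntegrableOn (fun t => v t (u t)) (Icc a b)

variable {v : ℝ → E → E} {a b K : ℝ}

theorem integral_const_mul_pow_factorial (a t K d : ℝ) (m : ℕ) :
    ∫ τ in a..t, K * ((K * (τ - a)) ^ m / (m.factorial : ℝ) * d) =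
      (K * (t - a)) ^ (m + 1) / ((m + 1).factorial : ℝ) * d := by
  have h : ∀ τ, K * ((K * (τ - a)) ^ m / (m.factorial : ℝ) * d) =
      (K ^ (m + 1) / (m.factorial : ℝ) * d) * (τ - a) ^ m := fun τ => by
    rw [mul_pow]
    ring
  simp only [h]
  rw [intervalIntegral.integral_const_mul, intervalIntegral.integral_comp_sub_right
    (fun x => x ^ m) a, integral_pow, Nat.factorial_succ]
  push_cast
  have := Nat.cast_ne_zero (R := ℝ).mpr m.factorial_ne_zero
  have : (m : ℝ) + 1 ≠ 0 := by positivity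
  rw [mul_pow, sub_self, zero_pow m.succ_ne_zero]
  field_simp
  ring

/-- The Picard operator of an integral equation. -/
def picardOp (hv : IsLipCaratheodory v a b K) (hab : a ≤ b) (x₀ : E) (u : C(Icc a b, E)) :
    C(Icc a b, E) where
  toFun t := x₀ + ∫ τ in a..t, v τ (IccExtend hab u τ)
  continuous_toFun := by
    have hint := hv.integrable _ (u.continuous.Icc_extend' (h := hab)).continuousOn
    have h := intervalIntegral.continuousOn_primitive_interval
      (hint.congr_set_ae (Eq.eventuallyEq (uIcc_of_le hab)))
    rw [uIcc_of_le hab] at h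
    exact continuous_const.add (continuousOn_iff_continuous_domRestrict.mp h)

theorem norm_picardOp_iterate_sub_le (hv : IsLipCaratheodory v a b K) (hab : a ≤ b) (x₀ : E)
    (u w : C(Icc a b, E)) (m : ℕ) (t : Icc a b) :
    ‖(picardOp hv hab x₀)^[m] u t - (picardOp hv hab x₀)^[m] w t‖ ≤
      (K * (t - a)) ^ m / (m.factorial : ℝ) * dist u w := by
  induction m generalizing t with
  | zero => simpa [← dist_eq_norm] using ContinuousMap.dist_apply_le_dist t
  | succ m ih =>
    rw [Function.iterate_succ_apply', Function.iterate_succ_apply']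
    set u' := (picardOp hv hab x₀)^[m] u
    set w' := (picardOp hv hab x₀)^[m] w
    have hsub : Icc a (t : ℝ) ⊆ Icc a b := Icc_subset_Icc_right t.2.2
    have hint : ∀ y : C(Icc a b, E),
        IntervalIntegrable (fun τ => v τ (IccExtend hab y τ)) volume a t := fun y => by
      refine ((hv.integrable _ (y.continuous.Icc_extend' (h := hab)).continuousOn).mono_set
        ?_).intervalIntegrable
      rwa [uIcc_of_le t.2.1]
    change ‖(x₀ + ∫ τ in a..t, v τ (IccExtend hab u' τ)) -
      (x₀ + ∫ τ in a..t, v τ (IccExtend hab w' τ))‖ ≤ _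
    rw [add_sub_add_left_eq_sub, ← intervalIntegral.integral_sub (hint u') (hint w'),
      ← integral_const_mul_pow_factorial]
    refine intervalIntegral.norm_integral_le_of_norm_le t.2.1 (ae_of_all _ fun τ hτ => ?_)
      (Continuous.intervalIntegrable (by fun_prop) _ _)
    have hτ' : τ ∈ Icc a b := hsub (Ioc_subset_Icc_self hτ)
    refine (hv.lip τ hτ' _ _).trans (mul_le_mul_of_nonneg_left ?_ hv.nonneg)
    rw [IccExtend_of_mem hab _ hτ', IccExtend_of_mem hab _ hτ']
    exact ih ⟨τ, hτ'⟩

theorem exists_contractingWith_picardOp_iterate (hv : IsLipCaratheodory v a b K) (hab : a ≤ b)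
    (x₀ : E) : ∃ (m : ℕ) (c : ℝ≥0), ContractingWith c (picardOp hv hab x₀)^[m] := by
  obtain ⟨m, hm⟩ := ((FloorSemiring.tendsto_pow_div_factorial_atTop (K * (b - a))).eventually
    (gt_mem_nhds one_pos)).exists
  have hc : 0 ≤ (K * (b - a)) ^ m / (m.factorial : ℝ) := by
    have := mul_nonneg hv.nonneg (sub_nonneg.mpr hab)
    positivity
  refine ⟨m, ⟨_, hc⟩, NNReal.coe_lt_coe.mp hm, LipschitzWith.of_dist_le_mul
    fun u w => ?_⟩
  refine (ContinuousMap.dist_le (mul_nonneg hc dist_nonneg)).mpr fun t => ?_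
  rw [dist_eq_norm]
  refine (norm_picardOp_iterate_sub_le hv hab x₀ u w m t).trans ?_
  have h1 : K * (t - a) ≤ K * (b - a) :=
    mul_le_mul_of_nonneg_left (sub_le_sub_right t.2.2 a) hv.nonneg
  have h2 : 0 ≤ K * (t - a) := mul_nonneg hv.nonneg (sub_nonneg.mpr t.2.1)
  change _ ≤ (K * (b - a)) ^ m / (m.factorial : ℝ) * dist u w
  gcongr

theorem exists_isIntegralSolution [CompleteSpace E] (hv : IsLipCaratheodory v a b K)
    (hab : a ≤ b) (x₀ : E) : ∃ u, IsIntegralSolution v a b x₀ u := by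
  obtain ⟨m, c, hc⟩ := exists_contractingWith_picardOp_iterate hv hab x₀
  have : Nonempty C(Icc a b, E) := ⟨0⟩
  have hfix := hc.isFixedPt_fixedPoint_iterate
  set u := ContractingWith.fixedPoint _ hc
  refine ⟨IccExtend hab u, (u.continuous.Icc_extend' (h := hab)).continuousOn, fun t ht => ?_⟩
  rw [IccExtend_of_mem hab _ ht]
  exact (congrArg (fun w : C(Icc a b, E) => w ⟨t, ht⟩) hfix).symm

theorem IsIntegralSolution.isFixedPt {x₀ : E} {u : ℝ → E} (hv : IsLipCaratheodory v a b K)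
    (hab : a ≤ b) (hu : IsIntegralSolution v a b x₀ u) :
    Function.IsFixedPt (picardOp hv hab x₀) ⟨(Icc a b).domRestrict u, hu.1.domRestrict⟩ := by
  ext t
  refine Eq.trans ?_ (hu.2 t t.2).symm
  change x₀ + ∫ τ in a..t, v τ (IccExtend hab ((Icc a b).domRestrict u) τ) = _
  congr 1
  refine intervalIntegral.integral_congr fun τ hτ => ?_
  rw [uIcc_of_le t.2.1] at hτ
  have hτ' : τ ∈ Icc a b := ⟨hτ.1, hτ.2.trans t.2.2⟩
  simp only [IccExtend_of_mem hab _ hτ', Set.domRestrict_apply]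

theorem IsIntegralSolution.eqOn {x₀ : E} {u w : ℝ → E} (hv : IsLipCaratheodory v a b K)
    (hab : a ≤ b) (hu : IsIntegralSolution v a b x₀ u) (hw : IsIntegralSolution v a b x₀ w) :
    EqOn u w (Icc a b) := by
  obtain ⟨m, c, hc⟩ := exists_contractingWith_picardOp_iterate hv hab x₀
  intro t ht
  exact congrArg (fun y : C(Icc a b, E) => y ⟨t, ht⟩)
    (hc.fixedPoint_unique' ((hu.isFixedPt hv hab).iterate m) ((hw.isFixedPt hv hab).iterate m))

end Caratheodory

/-! ### Bounded measurable functions on an interval -/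

namespace BddMeasOn

variable {a b : ℝ} {f g : ℝ → ℝ}

theorem const (c : ℝ) : BddMeasOn a b fun _ => c :=
  ⟨aemeasurable_const, |c|, fun _ _ => le_rfl⟩

theorem add (hf : BddMeasOn a b f) (hg : BddMeasOn a b g) : BddMeasOn a b fun t => f t + g t := by
  obtain ⟨hf, R, hR⟩ := hf
  obtain ⟨hg, S, hS⟩ := hg
  exact ⟨hf.add hg, R + S, fun t ht => (abs_add_le _ _).trans (add_le_add (hR t ht) (hS t ht))⟩

theorem mul (hf : BddMeasOn a b f) (hg : BddMeasOn a b g) : BddMeasOn a b fun t => f t * g t := by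
  obtain ⟨hf, R, hR⟩ := hf
  obtain ⟨hg, S, hS⟩ := hg
  refine ⟨hf.mul hg, R * S, fun t ht => ?_⟩
  rw [abs_mul]
  exact mul_le_mul (hR t ht) (hS t ht) (abs_nonneg _) ((abs_nonneg _).trans (hR t ht))

theorem neg (hf : BddMeasOn a b f) : BddMeasOn a b fun t => -f t := by
  simpa using (const (-1)).mul hf

theorem sub (hf : BddMeasOn a b f) (hg : BddMeasOn a b g) : BddMeasOn a b fun t => f t - g t := by
  simpa [sub_eq_add_neg] using hf.add hg.neg

theorem sum {ι : Type*} {s : Finset ι} {f : ι → ℝ → ℝ} (hf : ∀ i ∈ s, BddMeasOn a b (f i)) :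
    BddMeasOn a b fun t => ∑ i ∈ s, f i t := by
  classical
  induction s using Finset.induction_on with
  | empty => simpa using const 0
  | insert i s hi ih =>
    simp only [Finset.sum_insert hi]
    exact (hf i (by simp)).add (ih fun j hj => hf j (by simp [hj]))

theorem of_continuousOn (hf : ContinuousOn f (Icc a b)) : BddMeasOn a b f := by
  refine ⟨hf.aemeasurable measurableSet_Icc, ?_⟩
  obtain ⟨R, hR⟩ := isCompact_Icc.exists_bound_of_continuousOn hf
  exact ⟨R, hR⟩

theorem mono (hf : BddMeasOn a b f) {c d : ℝ} (h : Icc c d ⊆ Icc a b) : BddMeasOn c d f := by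
  obtain ⟨hf, R, hR⟩ := hf
  exact ⟨hf.mono_measure (Measure.restrict_mono h le_rfl), R, fun t ht => hR t (h ht)⟩

theorem integrableOn (hf : BddMeasOn a b f) : IntegrableOn f (Icc a b) := by
  obtain ⟨hf, R, hR⟩ := hf
  exact Integrable.of_bound hf.aestronglyMeasurable R
    ((ae_restrict_iff' measurableSet_Icc).mpr (ae_of_all _ hR))

end BddMeasOn

/-- A matrix function with measurable and bounded entries on `[a, b]`. -/
def MatBddMeasOn {m n : Type*} (a b : ℝ) (M : ℝ → Matrix m n ℝ) : Prop :=
  ∀ i j, BddMeasOn a b fun t => M t i j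

namespace MatBddMeasOn

variable {m n o m' n' : Type*} {a b : ℝ}

theorem const (M : Matrix m n ℝ) : MatBddMeasOn a b fun _ => M := fun i j => .const (M i j)

theorem add {M M' : ℝ → Matrix m n ℝ} (h : MatBddMeasOn a b M) (h' : MatBddMeasOn a b M') :
    MatBddMeasOn a b fun t => M t + M' t := fun i j => (h i j).add (h' i j)

theorem sub {M M' : ℝ → Matrix m n ℝ} (h : MatBddMeasOn a b M) (h' : MatBddMeasOn a b M') :
    MatBddMeasOn a b fun t => M t - M' t := fun i j => (h i j).sub (h' i j)

theorem neg {M : ℝ → Matrix m n ℝ} (h : MatBddMeasOn a b M) :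
    MatBddMeasOn a b fun t => -M t := fun i j => (h i j).neg

theorem smul {M : ℝ → Matrix m n ℝ} {f : ℝ → ℝ} (hf : BddMeasOn a b f) (h : MatBddMeasOn a b M) :
    MatBddMeasOn a b fun t => f t • M t := fun i j => hf.mul (h i j)

theorem mul [Fintype n] {M : ℝ → Matrix m n ℝ} {M' : ℝ → Matrix n o ℝ} (h : MatBddMeasOn a b M)
    (h' : MatBddMeasOn a b M') : MatBddMeasOn a b fun t => M t * M' t := fun i j => by
  simp only [Matrix.mul_apply]
  exact .sum fun k _ => (h i k).mul (h' k j)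

theorem transpose {M : ℝ → Matrix m n ℝ} (h : MatBddMeasOn a b M) :
    MatBddMeasOn a b fun t => (M t).transpose := fun i j => h j i

theorem fromRows {M : ℝ → Matrix m n ℝ} {M' : ℝ → Matrix m' n ℝ} (h : MatBddMeasOn a b M)
    (h' : MatBddMeasOn a b M') : MatBddMeasOn a b fun t => Matrix.fromRows (M t) (M' t) :=
  fun i j => by
    cases i with
    | inl i => exact h i j
    | inr i => exact h' i j

theorem fromCols {M : ℝ → Matrix m n ℝ} {M' : ℝ → Matrix m n' ℝ} (h : MatBddMeasOn a b M)
    (h' : MatBddMeasOn a b M') : MatBddMeasOn a b fun t => Matrix.fromCols (M t) (M' t) :=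
  fun i j => by
    cases j with
    | inl j => exact h i j
    | inr j => exact h' i j

theorem fromBlocks {M₁₁ : ℝ → Matrix m n ℝ} {M₁₂ : ℝ → Matrix m n' ℝ} {M₂₁ : ℝ → Matrix m' n ℝ}
    {M₂₂ : ℝ → Matrix m' n' ℝ} (h₁₁ : MatBddMeasOn a b M₁₁) (h₁₂ : MatBddMeasOn a b M₁₂)
    (h₂₁ : MatBddMeasOn a b M₂₁) (h₂₂ : MatBddMeasOn a b M₂₂) :
    MatBddMeasOn a b fun t => Matrix.fromBlocks (M₁₁ t) (M₁₂ t) (M₂₁ t) (M₂₂ t) :=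
  fun i j => by
    rcases i with i | i <;> rcases j with j | j
    exacts [h₁₁ i j, h₁₂ i j, h₂₁ i j, h₂₂ i j]

theorem mono {M : ℝ → Matrix m n ℝ} (h : MatBddMeasOn a b M) {c d : ℝ} (hcd : Icc c d ⊆ Icc a b) :
    MatBddMeasOn c d M := fun i j => (h i j).mono hcd

end MatBddMeasOn

/-! ### The matrix inequalities are affine in `(Q, ζ)` and bounded measurable in time -/

namespace FunnelProblem

variable {P : FunnelProblem}

namespace Zeta

theorem Y_comb (r s : ℝ) (ζ ζ' : P.Zeta) : Y (r • ζ + s • ζ') = r • Y ζ + s • Y ζ' := by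
  ext i j; simp [Y]

theorem Z_comb (r s : ℝ) (ζ ζ' : P.Zeta) : Z (r • ζ + s • ζ') = r • Z ζ + s • Z ζ' := by
  ext i j; simp [Z]

theorem N₁_comb (r s : ℝ) (ζ ζ' : P.Zeta) : N₁ (r • ζ + s • ζ') = r • N₁ ζ + s • N₁ ζ' := by
  ext i j; simp [N₁]

theorem N₂_comb (r s : ℝ) (ζ ζ' : P.Zeta) : N₂ (r • ζ + s • ζ') = r • N₂ ζ + s • N₂ ζ' := by
  ext i j; simp [N₂]

theorem lamW_comb (r s : ℝ) (ζ ζ' : P.Zeta) :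
    lamW (r • ζ + s • ζ') = r * lamW ζ + s * lamW ζ' := by
  simp [lamW]

theorem s_comb (r s : ℝ) (ζ ζ' : P.Zeta) :
    Zeta.s (r • ζ + s • ζ') = r • Zeta.s ζ + s • Zeta.s ζ' := by
  ext i; simp [Zeta.s]

end Zeta

theorem H11_comb (t r s : ℝ) (Q Q' : Matrix (Fin P.nx) (Fin P.nx) ℝ)
    (Y Y' : Matrix (Fin P.nu) (Fin P.nx) ℝ) :
    P.H11 t (r • Q + s • Q') (r • Y + s • Y') = r • P.H11 t Q Y + s • P.H11 t Q' Y' := by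
  simp only [H11, Matrix.mul_add, Matrix.mul_smul, smul_add, smul_sub]
  module

theorem dynRHS_comb (t r s : ℝ) (Q Q' : Matrix (Fin P.nx) (Fin P.nx) ℝ) (ζ ζ' : P.Zeta) :
    P.dynRHS t (r • Q + s • Q') (r • ζ + s • ζ') =
      r • P.dynRHS t Q ζ + s • P.dynRHS t Q' ζ' := by
  unfold dynRHS
  cases P.dyn with
  | lyapunov =>
    simp only [Zeta.Y_comb, Zeta.Z_comb, H11_comb, Matrix.transpose_add, Matrix.transpose_smul]
    module
  | direct => exact Zeta.Z_comb r s ζ ζ'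

theorem invBlock_comb (t r s : ℝ) (Q Q' : Matrix (Fin P.nx) (Fin P.nx) ℝ) (ζ ζ' : P.Zeta) :
    P.invBlock t (r • Q + s • Q') (r • ζ + s • ζ') =
      r • P.invBlock t Q ζ + s • P.invBlock t Q' ζ' := by
  unfold invBlock
  cases P.dyn with
  | lyapunov =>
    simp only [Zeta.Z_comb]
    module
  | direct =>
    simp only [Zeta.Y_comb, Zeta.Z_comb, H11_comb, Matrix.transpose_add, Matrix.transpose_smul]
    module

theorem H12_comb (t : ℝ) {r s : ℝ} (hrs : r + s = 1) (Q Q' : Matrix (Fin P.nx) (Fin P.nx) ℝ)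
    (ζ ζ' : P.Zeta) :
    P.H12 t (r • Q + s • Q') (r • ζ + s • ζ') = r • P.H12 t Q ζ + s • P.H12 t Q' ζ' := by
  obtain rfl : s = 1 - r := eq_sub_of_add_eq' hrs
  ext i j
  rcases i with i | i | i
  · simp [H12, Zeta.N₂_comb, Matrix.add_mul, Matrix.mul_assoc]
  · simp only [H12, Matrix.fromRows_apply_inl, Matrix.fromRows_apply_inr, Matrix.add_apply,
      Matrix.smul_apply, smul_eq_mul]
    ring
  · simp only [H12, Zeta.Y_comb, Matrix.mul_add, Matrix.mul_smul, Matrix.fromRows_apply_inr,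
      Matrix.add_apply, Matrix.smul_apply, smul_eq_mul]
    ring

theorem H22_comb (t : ℝ) {r s : ℝ} (hrs : r + s = 1) (ζ ζ' : P.Zeta) :
    P.H22 t (r • ζ + s • ζ') = r • P.H22 t ζ + s • P.H22 t ζ' := by
  obtain rfl : s = 1 - r := eq_sub_of_add_eq' hrs
  ext i j
  rcases i with i | i | i <;> rcases j with j | j | j <;>
    simp only [H22, Zeta.N₂_comb, Zeta.N₁_comb, Zeta.lamW_comb, Matrix.mul_add, Matrix.mul_smul,
      Matrix.fromBlocks_apply₁₁, Matrix.fromBlocks_apply₁₂, Matrix.fromBlocks_apply₂₁,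
      Matrix.fromBlocks_apply₂₂, Matrix.fromRows_apply_inl, Matrix.fromRows_apply_inr,
      Matrix.fromCols_apply_inl, Matrix.fromCols_apply_inr, Matrix.transpose_apply,
      Matrix.neg_apply, Matrix.zero_apply, Matrix.add_apply, Matrix.smul_apply, smul_eq_mul] <;>
    ring

theorem LMI_comb (l : P.LIdx) (t : ℝ) {r s : ℝ} (hrs : r + s = 1)
    (Q Q' : Matrix (Fin P.nx) (Fin P.nx) ℝ) (ζ ζ' : P.Zeta) :
    P.LMI l t (r • Q + s • Q') (r • ζ + s • ζ') = r • P.LMI l t Q ζ + s • P.LMI l t Q' ζ' := by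
  obtain rfl : s = 1 - r := eq_sub_of_add_eq' hrs
  ext i j
  change _ = r * P.LMI l t Q ζ i j + (1 - r) * P.LMI l t Q' ζ' i j
  rcases l with l | l | l | l
  · rcases i with i | i <;> rcases j with j | j <;>
      simp [LMI, invBlock_comb, H12_comb t hrs, H22_comb t hrs]
  · rcases i with i | i <;> rcases j with j | j <;>
      simp [LMI, Matrix.vecMul_add, Matrix.vecMul_smul, Matrix.add_mulVec, Matrix.smul_mulVec] <;>
      ring
  · rcases i with i | i <;> rcases j with j | j <;>
      simp [LMI, Zeta.Y_comb, Matrix.vecMul_add, Matrix.vecMul_smul, Matrix.add_mulVec,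
        Matrix.smul_mulVec] <;>
      ring
  · rcases i with i | i <;> rcases j with j | j <;>
      simp only [LMI, Zeta.Y_comb, Zeta.s_comb, Matrix.mul_add, Matrix.mul_smul, Matrix.neg_apply,
        Matrix.fromBlocks_apply₁₁, Matrix.fromBlocks_apply₁₂, Matrix.fromBlocks_apply₂₁,
        Matrix.fromBlocks_apply₂₂, Matrix.transpose_apply, Matrix.submatrix_apply,
        Matrix.add_apply, Matrix.smul_apply, Pi.add_apply, Pi.smul_apply, smul_eq_mul] <;>
      ring

section Regularity

variable {a b : ℝ} {Q : ℝ → Matrix (Fin P.nx) (Fin P.nx) ℝ} {ζ : ℝ → P.Zeta}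

theorem matBddMeasOn_T22_inv : MatBddMeasOn P.t0 P.tf fun t => (P.T22 t)⁻¹ := P.T22_inv_reg

theorem matBddMeasOn_T21 : MatBddMeasOn P.t0 P.tf P.T21 := fun _ _ => P.T_reg _ _

theorem matBddMeasOn_Lam : MatBddMeasOn P.t0 P.tf P.Lam :=
  MatBddMeasOn.mul (M := P.T12) (fun _ _ => P.T_reg _ _) matBddMeasOn_T22_inv

theorem matBddMeasOn_Sig : MatBddMeasOn P.t0 P.tf P.Sig :=
  MatBddMeasOn.sub (M := P.T11) (fun _ _ => P.T_reg _ _)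
    (MatBddMeasOn.mul matBddMeasOn_Lam matBddMeasOn_T21)

theorem matBddMeasOn_H11 (hab : Icc a b ⊆ Icc P.t0 P.tf) (hQ : MatBddMeasOn a b Q)
    {Y : ℝ → Matrix (Fin P.nu) (Fin P.nx) ℝ} (hY : MatBddMeasOn a b Y) :
    MatBddMeasOn a b fun t => P.H11 t (Q t) (Y t) :=
  .add (.sub (.add (.mul (MatBddMeasOn.mono P.A_reg hab) hQ)
      (.mul (MatBddMeasOn.mono P.B_reg hab) hY))
    (.mul (.mul (.mul (.const _) (matBddMeasOn_T22_inv.mono hab)) (matBddMeasOn_T21.mono hab))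
      (.add (.mul (.const _) hQ) (.mul (.const _) hY)))) (.smul (.const _) hQ)

theorem matBddMeasOn_dynRHS (hab : Icc a b ⊆ Icc P.t0 P.tf) (hQ : MatBddMeasOn a b Q)
    (hζ : ∀ c, BddMeasOn a b fun t => ζ t c) :
    MatBddMeasOn a b fun t => P.dynRHS t (Q t) (ζ t) := by
  unfold dynRHS
  cases P.dyn with
  | lyapunov =>
    have h := matBddMeasOn_H11 hab hQ (Y := fun t => (ζ t).Y) fun i j => hζ _
    exact (h.add h.transpose).add fun i j => hζ _
  | direct => exact fun i j => hζ _

theorem matBddMeasOn_invBlock (hab : Icc a b ⊆ Icc P.t0 P.tf) (hQ : MatBddMeasOn a b Q)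
    (hζ : ∀ c, BddMeasOn a b fun t => ζ t c) :
    MatBddMeasOn a b fun t => P.invBlock t (Q t) (ζ t) := by
  unfold invBlock
  cases P.dyn with
  | lyapunov => exact fun i j => (hζ _).neg
  | direct =>
    have h := matBddMeasOn_H11 hab hQ (Y := fun t => (ζ t).Y) fun i j => hζ _
    exact (h.add h.transpose).sub fun i j => hζ _

theorem matBddMeasOn_H12 (hab : Icc a b ⊆ Icc P.t0 P.tf) (hQ : MatBddMeasOn a b Q)
    (hζ : ∀ c, BddMeasOn a b fun t => ζ t c) :
    MatBddMeasOn a b fun t => P.H12 t (Q t) (ζ t) := by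
  have hT := matBddMeasOn_T22_inv.mono hab
  have hN₂ : MatBddMeasOn a b fun t => (ζ t).N₂ := fun i j => hζ _
  have hY : MatBddMeasOn a b fun t => (ζ t).Y := fun i j => hζ _
  have hF : MatBddMeasOn a b P.F := MatBddMeasOn.mono P.F_reg hab
  exact .fromRows (.mul (.mul hN₂ hT.transpose) (.const _))
    (.fromRows (.sub hF.transpose
        (.mul (.mul (.mul (.const _) (matBddMeasOn_T21.mono hab).transpose) hT.transpose)
          (.const _)))
      (.mul (matBddMeasOn_Sig.mono hab) (.add (.mul (.const _) hQ) (.mul (.const _) hY))))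

theorem matBddMeasOn_H22 (hab : Icc a b ⊆ Icc P.t0 P.tf)
    (hζ : ∀ c, BddMeasOn a b fun t => ζ t c) : MatBddMeasOn a b fun t => P.H22 t (ζ t) := by
  have hN₁ : MatBddMeasOn a b fun t => (ζ t).N₁ := fun i j => hζ _
  have hN₂ : MatBddMeasOn a b fun t => (ζ t).N₂ := fun i j => hζ _
  have hl : BddMeasOn a b fun t => (ζ t).lamW := hζ _
  have hLN := (matBddMeasOn_Lam.mono hab).mul hN₂
  have hSG := (matBddMeasOn_Sig.mono hab).mul (.const P.G)
  exact .fromBlocks hN₂.neg (.fromCols (.const 0) hLN.transpose) (.fromRows (.const 0) hLN)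
    (.fromBlocks (MatBddMeasOn.smul hl (.const 1)).neg hSG.transpose hSG hN₁.neg)

theorem bddMeasOn_dotProduct {m : Type*} [Fintype m] {x y : ℝ → m → ℝ}
    (hx : ∀ i, BddMeasOn a b fun t => x t i) (hy : ∀ i, BddMeasOn a b fun t => y t i) :
    BddMeasOn a b fun t => x t ⬝ᵥ y t :=
  .sum fun i _ => (hx i).mul (hy i)

theorem matBddMeasOn_LMI (l : P.LIdx) (hab : Icc a b ⊆ Icc P.t0 P.tf) (hQ : MatBddMeasOn a b Q)
    (hζ : ∀ c, BddMeasOn a b fun t => ζ t c) :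
    MatBddMeasOn a b fun t => P.LMI l t (Q t) (ζ t) := by
  have hY : MatBddMeasOn a b fun t => (ζ t).Y := fun i j => hζ _
  rcases l with l | l | l | l
  · exact .fromBlocks (matBddMeasOn_invBlock hab hQ hζ) (matBddMeasOn_H12 hab hQ hζ).transpose
      (matBddMeasOn_H12 hab hQ hζ) (matBddMeasOn_H22 hab hζ)
  · have ha : ∀ i, BddMeasOn a b fun t => P.ah l t i := fun i => (P.ah_reg l i).mono hab
    have hd := ((P.bh_reg l).mono hab).sub
      (bddMeasOn_dotProduct ha fun i => (P.xbar_reg i).mono hab)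
    refine .neg (.fromBlocks (fun _ _ => ?_) (fun _ j => ?_) (fun i _ => ?_)
      (.smul (.const _) hQ))
    · simpa [sq] using hd.mul hd
    · exact (BddMeasOn.const _).mul (bddMeasOn_dotProduct ha fun i => hQ i j)
    · exact (BddMeasOn.const _).mul (bddMeasOn_dotProduct (hQ i) ha)
  · have ha : ∀ i, BddMeasOn a b fun t => P.ag l t i := fun i => (P.ag_reg l i).mono hab
    have hd := ((P.bg_reg l).mono hab).sub
      (bddMeasOn_dotProduct ha fun i => (P.ubar_reg i).mono hab)
    refine .neg (.fromBlocks (fun _ _ => ?_) (fun _ j => ?_) (fun i _ => ?_)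
      (.smul (.const _) hQ))
    · simpa [sq] using hd.mul hd
    · exact (BddMeasOn.const _).mul (bddMeasOn_dotProduct ha fun i => hY i j)
    · exact (BddMeasOn.const _).mul (bddMeasOn_dotProduct (fun j => hY j i) ha)
  · have hs : BddMeasOn a b fun t => (ζ t).s l := hζ _
    have h := (MatBddMeasOn.const P.C).mul hQ |>.add ((MatBddMeasOn.const P.D).mul hY)
    exact .neg (.fromBlocks (.smul hs (.const 1)) (fun i j => h i.1 j) (fun i j => h j.1 i) hQ)

end Regularity

end FunnelProblem

namespace FunnelProblem

variable {P : FunnelProblem}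

/-! ### The funnel path depends linearly on the decision variables -/

theorem node_lt_node_succ (P : FunnelProblem) (k : ℕ) : P.node k < P.node (k + 1) := by
  have hN : (0 : ℝ) < P.N := Nat.cast_pos.mpr P.N_pos
  have ht := sub_pos.mpr P.t0_lt_tf
  have : (k : ℝ) < ((k + 1 : ℕ) : ℝ) := by simp
  unfold node
  gcongr

theorem Icc_node_subset {k : ℕ} (hk : k < P.N) :
    Icc (P.node k) (P.node (k + 1)) ⊆ Icc P.t0 P.tf := by
  have hN : (0 : ℝ) < P.N := Nat.cast_pos.mpr P.N_pos
  have ht := (sub_pos.mpr P.t0_lt_tf).le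
  refine Icc_subset_Icc (le_add_of_nonneg_right (by positivity)) ?_
  have h : ((k + 1 : ℕ) : ℝ) / P.N ≤ 1 := (div_le_one hN).mpr (by exact_mod_cast hk)
  have := mul_le_mul_of_nonneg_right h ht
  unfold node
  linarith

theorem Chi.q_comb (r s : ℝ) (χ χ' : P.Chi) : q (r • χ + s • χ') = r • q χ + s • q χ' := by
  ext i; simp [q]

theorem Chi.ζm_comb (r s : ℝ) (χ χ' : P.Chi) : ζm (r • χ + s • χ') = r • ζm χ + s • ζm χ' := by
  ext i; simp [ζm]

theorem Chi.ζp_comb (r s : ℝ) (χ χ' : P.Chi) : ζp (r • χ + s • χ') = r • ζp χ + s • ζp χ' := by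
  ext i; simp [ζp]

theorem mat_comb (r s : ℝ) (q q' : P.QVec) : mat (r • q + s • q') = r • mat q + s • mat q' := by
  ext i j; simp [mat]

theorem foh_comb (k : ℕ) (r s : ℝ) (χ χ' : P.Chi) (t : ℝ) :
    P.foh k (r • χ + s • χ') t = r • P.foh k χ t + s • P.foh k χ' t := by
  simp only [foh, Chi.ζm_comb, Chi.ζp_comb]
  module

theorem bddMeasOn_foh (k : ℕ) (χ : P.Chi) (a b : ℝ) (c : P.ZIdx) :
    BddMeasOn a b fun t => P.foh k χ t c := by
  refine .of_continuousOn (Continuous.continuousOn ?_)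
  simp only [foh, PiLp.add_apply, PiLp.smul_apply, smul_eq_mul]
  fun_prop

/-- The right-hand side of the funnel dynamics on the `k`-th subinterval as a time-dependent
vector field on a normed space (matrices with the entrywise maximum norm). -/
def dynField (k : ℕ) (χ : P.Chi) (τ : ℝ) (Q : Fin P.nx → Fin P.nx → ℝ) : Fin P.nx → Fin P.nx → ℝ :=
  P.dynRHS τ Q (P.foh k χ τ)

/-- The linear part of the funnel dynamics. -/
def dynLin (P : FunnelProblem) (t : ℝ) :
    (Fin P.nx → Fin P.nx → ℝ) →ₗ[ℝ] (Fin P.nx → Fin P.nx → ℝ) where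
  toFun R := P.dynRHS t R 0
  map_add' R R' := by
    have h : ∀ R R' : Matrix (Fin P.nx) (Fin P.nx) ℝ,
        P.dynRHS t (R + R') 0 = P.dynRHS t R 0 + P.dynRHS t R' 0 := fun R R' => by
      simpa using P.dynRHS_comb t 1 1 R R' 0 0
    exact h R R'
  map_smul' r R := by
    have h : ∀ R : Matrix (Fin P.nx) (Fin P.nx) ℝ,
        P.dynRHS t (r • R) 0 = r • P.dynRHS t R 0 := fun R => by
      simpa using P.dynRHS_comb t r 0 R 0 0 0
    exact h R

theorem dynRHS_sub (t : ℝ) (Q Q' : Matrix (Fin P.nx) (Fin P.nx) ℝ) (ζ : P.Zeta) :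
    P.dynRHS t Q ζ - P.dynRHS t Q' ζ = P.dynRHS t (Q - Q') 0 := by
  simpa [sub_eq_add_neg] using (P.dynRHS_comb t 1 (-1) Q Q' ζ ζ).symm

theorem exists_abs_dynLin_le (P : FunnelProblem) : ∃ K : ℝ, 0 ≤ K ∧ ∀ t ∈ Icc P.t0 P.tf,
    ∀ (R : Fin P.nx → Fin P.nx → ℝ) i j, |P.dynLin t R i j| ≤ K * ‖R‖ := by
  let e : Fin P.nx → Fin P.nx → Fin P.nx → Fin P.nx → ℝ := fun p q => Pi.single p (Pi.single q 1)
  have hb : ∀ p q i j, ∃ c : ℝ, ∀ t ∈ Icc P.t0 P.tf, |P.dynLin t (e p q) i j| ≤ c := fun p q i j =>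
    (matBddMeasOn_dynRHS subset_rfl (.const (e p q))
      (ζ := fun _ => (0 : P.Zeta)) (fun _ => .const 0) i j).2
  choose c hc using hb
  have hc0 : ∀ p q i j, 0 ≤ c p q i j := fun p q i j =>
    (abs_nonneg _).trans (hc p q i j P.t0 ⟨le_rfl, P.t0_lt_tf.le⟩)
  refine ⟨∑ i, ∑ j, ∑ p, ∑ q, c p q i j, Finset.sum_nonneg fun i _ => Finset.sum_nonneg fun j _ =>
    Finset.sum_nonneg fun p _ => Finset.sum_nonneg fun q _ => hc0 p q i j, fun t ht R i j => ?_⟩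
  have hR : R = ∑ p, ∑ q, R p q • e p q := by
    funext a b
    simp [e, Finset.sum_apply, Pi.single_apply, ite_apply]
  have h1 : P.dynLin t R i j = ∑ p, ∑ q, R p q * P.dynLin t (e p q) i j := by
    conv_lhs => rw [hR]
    simp only [map_sum, map_smul, Finset.sum_apply, Pi.smul_apply, smul_eq_mul]
  have h2 : |P.dynLin t R i j| ≤ ∑ p, ∑ q, c p q i j * ‖R‖ := by
    rw [h1]
    refine (Finset.abs_sum_le_sum_abs _ _).trans (Finset.sum_le_sum fun p _ => ?_)
    refine (Finset.abs_sum_le_sum_abs _ _).trans (Finset.sum_le_sum fun q _ => ?_)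
    rw [abs_mul, mul_comm]
    exact mul_le_mul (hc p q i j t ht) ((norm_le_pi_norm (R p) q).trans (norm_le_pi_norm R p))
      (abs_nonneg _) (hc0 p q i j)
  refine h2.trans ?_
  simp only [← Finset.sum_mul]
  refine mul_le_mul_of_nonneg_right ?_ (norm_nonneg _)
  have h3 : ∀ i j, 0 ≤ ∑ p, ∑ q, c p q i j := fun i j =>
    Finset.sum_nonneg fun p _ => Finset.sum_nonneg fun q _ => hc0 p q i j
  exact (Finset.single_le_sum (f := fun j => ∑ p, ∑ q, c p q i j) (fun j _ => h3 i j)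
    (Finset.mem_univ j)).trans (Finset.single_le_sum (f := fun i => ∑ j, ∑ p, ∑ q, c p q i j)
    (fun i _ => Finset.sum_nonneg fun j _ => h3 i j) (Finset.mem_univ i))

theorem matBddMeasOn_of_continuousOn {m n : Type*} {a b : ℝ} {Q : ℝ → Matrix m n ℝ}
    (hQ : ContinuousOn Q (Icc a b)) : MatBddMeasOn a b Q := fun i j =>
  .of_continuousOn ((continuous_id.matrix_elem i j).comp_continuousOn hQ)

theorem matBddMeasOn_dynRHS_foh {k : ℕ} (hk : k < P.N) (χ : P.Chi)
    {Q : ℝ → Matrix (Fin P.nx) (Fin P.nx) ℝ}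
    (hQ : ContinuousOn Q (Icc (P.node k) (P.node (k + 1)))) :
    MatBddMeasOn (P.node k) (P.node (k + 1)) fun τ => P.dynRHS τ (Q τ) (P.foh k χ τ) :=
  matBddMeasOn_dynRHS (Icc_node_subset hk) (matBddMeasOn_of_continuousOn hQ)
    fun c => bddMeasOn_foh k χ _ _ c

theorem exists_isLipCaratheodory_dynField {k : ℕ} (hk : k < P.N) (χ : P.Chi) :
    ∃ K, IsLipCaratheodory (dynField k χ) (P.node k) (P.node (k + 1)) K := by
  obtain ⟨K, hK, hlip⟩ := P.exists_abs_dynLin_le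
  refine ⟨K, hK, fun t ht x y => ?_, fun u hu => ?_⟩
  · have hnn := mul_nonneg hK (norm_nonneg (x - y))
    refine (pi_norm_le_iff_of_nonneg hnn).mpr fun i =>
      (pi_norm_le_iff_of_nonneg hnn).mpr fun j => ?_
    have := hlip t (Icc_node_subset hk ht) (x - y) i j
    have h := congrFun (congrFun (dynRHS_sub t x y (P.foh k χ t)) i) j
    exact (congrArg abs h).trans_le this
  · have h := matBddMeasOn_dynRHS_foh hk χ hu
    exact Integrable.of_eval fun i => Integrable.of_eval fun j => (h i j).integrableOn

theorem isFunnelPath_iff {k : ℕ} (hk : k < P.N) (χ : P.Chi)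
    (Q : ℝ → Matrix (Fin P.nx) (Fin P.nx) ℝ) :
    P.IsFunnelPath k χ Q ↔
      IsIntegralSolution (E := Fin P.nx → Fin P.nx → ℝ) (dynField k χ) (P.node k) (P.node (k + 1))
        (mat χ.q) Q := by
  obtain ⟨K, hK⟩ := exists_isLipCaratheodory_dynField hk χ
  refine and_congr_right fun hc => forall₂_congr fun t ht => ?_
  have hint : IntervalIntegrable (fun τ => dynField k χ τ (Q τ))
      volume (P.node k) t := by
    refine ((hK.integrable Q hc).mono_set ?_).intervalIntegrable
    rw [uIcc_of_le ht.1]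
    exact Icc_subset_Icc_right ht.2
  have hev : ∀ i j, (∫ τ in (P.node k)..t, dynField k χ τ (Q τ)) i j =
      ∫ τ in (P.node k)..t, P.dynRHS τ (Q τ) (P.foh k χ τ) i j := fun i j =>
    (ContinuousLinearMap.intervalIntegral_comp_comm
      ((ContinuousLinearMap.proj (R := ℝ) (φ := fun _ : Fin P.nx => ℝ) j).comp
        (ContinuousLinearMap.proj (R := ℝ) (φ := fun _ : Fin P.nx => Fin P.nx → ℝ) i)) hint).symm
  constructor
  · intro h
    funext i j
    exact (h i j).trans (congrArg (mat χ.q i j + ·) (hev i j).symm)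
  · intro h i j
    exact (congrFun (congrFun h i) j).trans (congrArg (mat χ.q i j + ·) (hev i j))

theorem isFunnelPath_path {k : ℕ} (hk : k < P.N) (χ : P.Chi) :
    P.IsFunnelPath k χ (P.path k χ) := by
  obtain ⟨K, hK⟩ := exists_isLipCaratheodory_dynField hk χ
  obtain ⟨u, hu⟩ := exists_isIntegralSolution hK (P.node_lt_node_succ k).le (mat χ.q)
  exact Classical.epsilon_spec ⟨u, (isFunnelPath_iff hk χ u).mpr hu⟩

theorem IsFunnelPath.eqOn_path {k : ℕ} (hk : k < P.N) {χ : P.Chi}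
    {Q : ℝ → Matrix (Fin P.nx) (Fin P.nx) ℝ} (hQ : P.IsFunnelPath k χ Q) :
    EqOn Q (P.path k χ) (Icc (P.node k) (P.node (k + 1))) := by
  obtain ⟨K, hK⟩ := exists_isLipCaratheodory_dynField hk χ
  exact IsIntegralSolution.eqOn (E := Fin P.nx → Fin P.nx → ℝ) hK (P.node_lt_node_succ k).le
    ((isFunnelPath_iff hk χ Q).mp hQ) ((isFunnelPath_iff hk χ _).mp (isFunnelPath_path hk χ))

/-- By uniqueness, a linear combination of funnel paths is the funnel path of the combination of the
decision variables. -/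
theorem path_comb {k : ℕ} (hk : k < P.N) (r s : ℝ) (χ χ' : P.Chi) {t : ℝ}
    (ht : t ∈ Icc (P.node k) (P.node (k + 1))) :
    P.path k (r • χ + s • χ') t = r • P.path k χ t + s • P.path k χ' t := by
  refine (IsFunnelPath.eqOn_path hk (Q := fun t => r • P.path k χ t + s • P.path k χ' t)
    ⟨?_, fun t ht i j => ?_⟩ ht).symm
  · exact ((isFunnelPath_path hk χ).1.const_smul r).add ((isFunnelPath_path hk χ').1.const_smul s)
  · have hint : ∀ χ : P.Chi, IntervalIntegrable
        (fun τ => P.dynRHS τ (P.path k χ τ) (P.foh k χ τ) i j) volume (P.node k) t := fun χ => by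
      have h := (matBddMeasOn_dynRHS_foh hk χ (isFunnelPath_path hk χ).1 i j).integrableOn
      refine (h.mono_set ?_).intervalIntegrable
      rw [uIcc_of_le ht.1]
      exact Icc_subset_Icc_right ht.2
    simp only [foh_comb, dynRHS_comb, Chi.q_comb, mat_comb, Matrix.add_apply, Matrix.smul_apply,
      smul_eq_mul]
    rw [intervalIntegral.integral_add ((hint χ).const_mul r) ((hint χ').const_mul s),
      intervalIntegral.integral_const_mul, intervalIntegral.integral_const_mul,
      (isFunnelPath_path hk χ).2 t ht i j, (isFunnelPath_path hk χ').2 t ht i j]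
    ring

theorem LChi_comb {k : ℕ} (hk : k < P.N) (l : P.LIdx) {t : ℝ}
    (ht : t ∈ Icc (P.node k) (P.node (k + 1))) {r s : ℝ} (hrs : r + s = 1) (χ χ' : P.Chi) :
    P.LChi k l t (r • χ + s • χ') = r • P.LChi k l t χ + s • P.LChi k l t χ' := by
  unfold LChi
  rw [path_comb hk r s χ χ' ht, foh_comb, LMI_comb l t hrs]

theorem matBddMeasOn_LChi {k : ℕ} (hk : k < P.N) (l : P.LIdx) (χ : P.Chi) :
    MatBddMeasOn (P.node k) (P.node (k + 1)) fun t => P.LChi k l t χ :=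
  matBddMeasOn_LMI l (Icc_node_subset hk)
    (matBddMeasOn_of_continuousOn (isFunnelPath_path hk χ).1) fun c => bddMeasOn_foh k χ _ _ c

end FunnelProblem

/-! ### Functions that preserve affine combinations -/

section AffineComb

variable {V : Type*} [AddCommGroup V] [Module ℝ V]

/-- `f` preserves affine combinations of two points. -/
def PreservesAffineComb {W : Type*} [AddCommGroup W] [Module ℝ W] (f : V → W) : Prop :=
  ∀ r s : ℝ, r + s = 1 → ∀ x y, f (r • x + s • y) = r • f x + s • f y

theorem PreservesAffineComb.exists_linearMap {f : V → ℝ} (hf : PreservesAffineComb f) :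
    ∃ φ : V →ₗ[ℝ] ℝ, ∀ x, f x = φ x + f 0 := by
  have hsmul : ∀ (r : ℝ) x, f (r • x) - f 0 = r * (f x - f 0) := fun r x => by
    have h := hf r (1 - r) (by ring) x 0
    simp only [smul_zero, add_zero, smul_eq_mul] at h
    rw [h]
    ring
  refine ⟨{ toFun := fun x => f x - f 0, map_add' := fun x y => ?_, map_smul' := hsmul },
    fun x => by simp⟩
  have h := hf (1 / 2) (1 / 2) (by norm_num) ((2 : ℝ) • x) ((2 : ℝ) • y)
  have h1 := hsmul 2 x
  have h2 := hsmul 2 y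
  simp only [smul_smul, smul_eq_mul] at h
  norm_num at h
  linarith

theorem PreservesAffineComb.continuous {V : Type*} [NormedAddCommGroup V] [NormedSpace ℝ V]
    [FiniteDimensional ℝ V] {f : V → ℝ} (hf : PreservesAffineComb f) : Continuous f := by
  obtain ⟨φ, hφ⟩ := hf.exists_linearMap
  rw [funext hφ]
  exact φ.continuous_of_finiteDimensional.add continuous_const

theorem PreservesAffineComb.inner_gradient {V : Type*} [NormedAddCommGroup V]
    [InnerProductSpace ℝ V] [FiniteDimensional ℝ V] {f : V → ℝ} (hf : PreservesAffineComb f)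
    (x v : V) : inner ℝ (∇ f x) v = f (x + v) - f x := by
  obtain ⟨φ, hφ⟩ := hf.exists_linearMap
  have hd : HasFDerivAt f (LinearMap.toContinuousLinearMap φ) x := by
    rw [funext hφ]
    exact (LinearMap.toContinuousLinearMap φ).hasFDerivAt.add_const _
  rw [gradient, InnerProductSpace.toDual_symm_apply, hd.fderiv, hφ, hφ x, map_add]
  simp

end AffineComb

/-! ### The scalar penalty `s ↦ max(0, s) ^ p` -/

theorem penaltyDeriv_nonneg {p : ℝ} (hp : 1 ≤ p) (s : ℝ) : 0 ≤ penaltyDeriv p s := by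
  unfold penaltyDeriv
  split_ifs with hs
  · positivity
  · exact le_rfl

theorem penalty_add_penaltyDeriv_le {p : ℝ} (hp : 1 ≤ p) (s s' : ℝ) :
    max 0 s ^ p + penaltyDeriv p s * (s' - s) ≤ max 0 s' ^ p := by
  unfold penaltyDeriv
  split_ifs with hs
  · have hB := one_add_mul_self_le_rpow_one_add (s := max 0 s' / s - 1) (p := p)
      (by have := div_nonneg (le_max_left 0 s') hs.le; linarith) hp
    rw [add_sub_cancel, Real.div_rpow (le_max_left _ _) hs.le,
      le_div_iff₀ (Real.rpow_pos_of_pos hs p)] at hB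
    have hsp : s ^ p = s ^ (p - 1) * s := by
      rw [← Real.rpow_add_one hs.ne', sub_add_cancel]
    have hpos : 0 ≤ p * s ^ (p - 1) := by positivity
    have hle := mul_le_mul_of_nonneg_left (sub_le_sub_right (le_max_right 0 s') s) hpos
    have hexp : (1 + p * (max 0 s' / s - 1)) * s ^ p =
        s ^ p + p * s ^ (p - 1) * (max 0 s' - s) := by
      rw [hsp]
      field_simp
    rw [max_eq_right hs.le]
    linarith
  · rw [max_eq_left (not_lt.mp hs), Real.zero_rpow (by linarith)]
    simpa using Real.rpow_nonneg (le_max_left 0 s') p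

theorem penaltyDeriv_le {p R s : ℝ} (hp : 1 ≤ p) (hs : |s| ≤ R) :
    penaltyDeriv p s ≤ p * R ^ (p - 1) := by
  have hR : 0 ≤ R := (abs_nonneg s).trans hs
  unfold penaltyDeriv
  split_ifs with h0
  · have := (le_abs_self s).trans hs
    gcongr
  · positivity

/-- The penalty is Lipschitz on bounded intervals. -/
theorem abs_penalty_sub_le {p R s s' : ℝ} (hp : 1 ≤ p) (hs : |s| ≤ R) (hs' : |s'| ≤ R) :
    |max 0 s' ^ p - max 0 s ^ p| ≤ p * R ^ (p - 1) * |s' - s| := by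
  have key : ∀ x y : ℝ, |x| ≤ R → max 0 x ^ p - max 0 y ^ p ≤ p * R ^ (p - 1) * |y - x| := by
    intro x y hx
    have h1 := penalty_add_penaltyDeriv_le hp x y
    have h2 := mul_le_mul_of_nonneg_right (penaltyDeriv_le hp hx) (abs_nonneg (y - x))
    have h3 := mul_le_mul_of_nonneg_left (neg_abs_le (y - x)) (penaltyDeriv_nonneg hp x)
    linarith
  refine abs_le.mpr ⟨?_, ?_⟩
  · linarith [key s s' hs]
  · rw [abs_sub_comm s' s]
    exact key s' s hs'

theorem hasDerivAt_penalty {p : ℝ} (hp : 1 < p) (s : ℝ) :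
    HasDerivAt (fun s : ℝ => max 0 s ^ p) (penaltyDeriv p s) s := by
  rcases lt_trichotomy s 0 with hs | rfl | hs
  · rw [penaltyDeriv, if_neg hs.not_gt]
    refine (hasDerivAt_const s ((0 : ℝ) ^ p)).congr_of_eventuallyEq ?_
    filter_upwards [gt_mem_nhds hs] with x hx
    rw [max_eq_left hx.le]
  · rw [penaltyDeriv, if_neg (lt_irrefl _)]
    -- At the kink, `0 ≤ max(0, s) ^ p ≤ |s| ^ (p - 1) |s|`.
    rw [hasDerivAt_iff_isLittleO, Asymptotics.isLittleO_iff]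
    intro c hc
    have ht : Tendsto (fun x : ℝ => |x| ^ (p - 1)) (𝓝 0) (𝓝 0) := by
      have : ContinuousAt (fun x : ℝ => |x| ^ (p - 1)) 0 :=
        continuous_abs.continuousAt.rpow_const (Or.inr (by linarith))
      simpa [ContinuousAt, Real.zero_rpow (sub_pos.mpr hp).ne'] using this
    filter_upwards [ht.eventually (gt_mem_nhds hc)] with x hx
    have h0 : (0 : ℝ) ^ p = 0 := Real.zero_rpow (by linarith)
    simp only [max_self, h0, sub_zero, smul_zero, Real.norm_eq_abs]
    have hm : max 0 x ≤ |x| := max_le (abs_nonneg x) (le_abs_self x)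
    rw [abs_of_nonneg (Real.rpow_nonneg (le_max_left 0 x) p)]
    calc max 0 x ^ p ≤ |x| ^ p := Real.rpow_le_rpow (le_max_left 0 x) hm (by linarith)
      _ = |x| ^ (p - 1) * |x| := by
        conv_rhs => rw [← Real.rpow_one |x|, ← Real.rpow_mul (abs_nonneg x), one_mul]
        rw [← Real.rpow_add' (abs_nonneg x) (by linarith), sub_add_cancel]
      _ ≤ c * |x| := mul_le_mul_of_nonneg_right hx.le (abs_nonneg x)
  · rw [penaltyDeriv, if_pos hs]
    refine (Real.hasDerivAt_rpow_const (Or.inl hs.ne')).congr_of_eventuallyEq ?_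
    filter_upwards [lt_mem_nhds hs] with x hx
    rw [max_eq_right hx.le]

theorem continuous_penalty {p : ℝ} (hp : 1 ≤ p) : Continuous fun s : ℝ => max 0 s ^ p :=
  (continuous_const.max continuous_id).rpow_const fun _ => Or.inr (by linarith)

theorem measurable_penaltyDeriv (p : ℝ) : Measurable (penaltyDeriv p) := by
  unfold penaltyDeriv
  exact Measurable.ite measurableSet_Ioi (by fun_prop) measurable_const

namespace BddMeasOn

variable {a b : ℝ} {f g : ℝ → ℝ}

theorem congr (hf : BddMeasOn a b f) (h : EqOn f g (Icc a b)) : BddMeasOn a b g := by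
  obtain ⟨hf, R, hR⟩ := hf
  refine ⟨hf.congr ?_, R, fun t ht => h ht ▸ hR t ht⟩
  exact (ae_restrict_iff' measurableSet_Icc).mpr (ae_of_all _ h)

theorem penalty (hf : BddMeasOn a b f) {p : ℝ} (hp : 1 ≤ p) :
    BddMeasOn a b fun t => max 0 (f t) ^ p := by
  obtain ⟨hf, R, hR⟩ := hf
  refine ⟨(continuous_penalty hp).measurable.comp_aemeasurable hf, R ^ p, fun t ht => ?_⟩
  rw [abs_of_nonneg (Real.rpow_nonneg (le_max_left _ _) _)]
  exact Real.rpow_le_rpow (le_max_left _ _) (max_le ((abs_nonneg _).trans (hR t ht))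
    ((le_abs_self _).trans (hR t ht))) (by linarith)

theorem penaltyDeriv (hf : BddMeasOn a b f) {p : ℝ} (hp : 1 ≤ p) :
    BddMeasOn a b fun t => penaltyDeriv p (f t) := by
  obtain ⟨hf, R, hR⟩ := hf
  refine ⟨(measurable_penaltyDeriv p).comp_aemeasurable hf, p * R ^ (p - 1), fun t ht => ?_⟩
  rw [abs_of_nonneg (penaltyDeriv_nonneg hp _)]
  exact penaltyDeriv_le hp (hR t ht)

end BddMeasOn

namespace MatBddMeasOn

variable {n : Type*} [Fintype n] {a b : ℝ} {M : ℝ → Matrix n n ℝ}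

theorem exists_entrySum_le (hM : MatBddMeasOn a b M) :
    ∃ R, ∀ t ∈ Icc a b, entrySum (M t) ≤ R := by
  choose R hR using fun i j => (hM i j).2
  exact ⟨∑ i, ∑ j, R i j, fun t ht =>
    Finset.sum_le_sum fun i _ => Finset.sum_le_sum fun j _ => hR i j t ht⟩

theorem lamMax [DecidableEq n] (hM : MatBddMeasOn a b M) :
    BddMeasOn a b fun t => lamMax (M t) := by
  obtain ⟨R, hR⟩ := hM.exists_entrySum_le
  exact ⟨aemeasurable_continuous_matrix (fun i j => (hM i j).1) continuous_lamMax, R,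
    fun t ht => (abs_lamMax_le _).trans (hR t ht)⟩

theorem topAvg [DecidableEq n] (hM : MatBddMeasOn a b M) :
    MatBddMeasOn a b fun t => topAvg (M t) := fun i j =>
  ⟨aemeasurable_topAvg (fun i j => (hM i j).1) i j, 1, fun _ _ => abs_topAvg_le_one _ _ _⟩

end MatBddMeasOn

namespace FunnelProblem

variable {P : FunnelProblem} {k : ℕ} {l : P.LIdx}

/-! ### The constraint functions `h` and their subgradients `g` -/

theorem preservesAffineComb_LChi (hk : k < P.N) (l : P.LIdx) {t : ℝ}
    (ht : t ∈ Icc (P.node k) (P.node (k + 1))) (i j : P.Blk l) :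
    PreservesAffineComb fun χ => P.LChi k l t χ i j := fun _ _ hrs χ χ' =>
  congrArg (fun M : Matrix (P.Blk l) (P.Blk l) ℝ => M i j) (LChi_comb hk l ht hrs χ χ')

theorem inner_gInt (hk : k < P.N) (l : P.LIdx) {t : ℝ}
    (ht : t ∈ Icc (P.node k) (P.node (k + 1))) (χ v : P.Chi) :
    inner ℝ (P.gInt k l t χ) v = penaltyDeriv (P.p l) (lamMax (P.LChi k l t χ)) *
      frobPair (topAvg (P.LChi k l t χ)) (P.LChi k l t (χ + v) - P.LChi k l t χ) := by
  simp only [gInt, real_inner_smul_left, sum_inner, frobPair]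
  congr 1
  refine Finset.sum_congr rfl fun i _ => Finset.sum_congr rfl fun j _ => ?_
  rw [(preservesAffineComb_LChi hk l ht i j).inner_gradient]
  rfl

theorem bddMeasOn_inner_gInt (hk : k < P.N) (l : P.LIdx) (χ v : P.Chi) :
    BddMeasOn (P.node k) (P.node (k + 1)) fun t => inner ℝ (P.gInt k l t χ) v := by
  have hM := matBddMeasOn_LChi hk l
  refine BddMeasOn.congr ?_ fun t ht => (inner_gInt hk l ht χ v).symm
  refine ((hM χ).lamMax.penaltyDeriv (P.one_le_p l)).mul (.sum fun i _ => .sum fun j _ => ?_)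
  exact ((hM χ).topAvg i j).mul (((hM (χ + v)).sub (hM χ)) i j)

theorem integrableOn_gInt (hk : k < P.N) (l : P.LIdx) (χ : P.Chi) :
    IntegrableOn (fun t => P.gInt k l t χ) (Icc (P.node k) (P.node (k + 1))) := by
  have hb := EuclideanSpace.basisFun ((Fin P.nx × Fin P.nx) ⊕ P.ZIdx ⊕ P.ZIdx) ℝ
  have h : ∀ t, P.gInt k l t χ = ∑ c, inner ℝ (P.gInt k l t χ) (hb c) • hb c := fun t => by
    conv_lhs => rw [← hb.sum_repr' (P.gInt k l t χ)]
    simp only [real_inner_comm]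
  rw [funext h]
  exact integrable_finsetSum _ fun c _ =>
    (bddMeasOn_inner_gInt hk l χ (hb c)).integrableOn.smul_const _

theorem integrableOn_penalty_lamMax (hk : k < P.N) (l : P.LIdx) (χ : P.Chi) :
    IntegrableOn (fun t => max 0 (lamMax (P.LChi k l t χ)) ^ P.p l)
      (Icc (P.node k) (P.node (k + 1))) :=
  ((matBddMeasOn_LChi hk l χ).lamMax.penalty (P.one_le_p l)).integrableOn

theorem h_eq_setIntegral (P : FunnelProblem) (k : ℕ) (l : P.LIdx) (χ : P.Chi) : P.h k l χ =
    ∫ t in Icc (P.node k) (P.node (k + 1)), max 0 (lamMax (P.LChi k l t χ)) ^ P.p l := by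
  rw [h, intervalIntegral.integral_of_le (P.node_lt_node_succ k).le, integral_Icc_eq_integral_Ioc]

theorem g_eq_setIntegral (P : FunnelProblem) (k : ℕ) (l : P.LIdx) (χ : P.Chi) : P.g k l χ =
    ∫ t in Icc (P.node k) (P.node (k + 1)), P.gInt k l t χ := by
  rw [g, intervalIntegral.integral_of_le (P.node_lt_node_succ k).le, integral_Icc_eq_integral_Ioc]

theorem penalty_lamMax_add_inner_gInt_le (hk : k < P.N) (l : P.LIdx) {t : ℝ}
    (ht : t ∈ Icc (P.node k) (P.node (k + 1))) (χ χ' : P.Chi) :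
    max 0 (lamMax (P.LChi k l t χ)) ^ P.p l + inner ℝ (P.gInt k l t χ) (χ' - χ) ≤
      max 0 (lamMax (P.LChi k l t χ')) ^ P.p l := by
  have h1 := penalty_add_penaltyDeriv_le (P.one_le_p l) (lamMax (P.LChi k l t χ))
    (lamMax (P.LChi k l t χ'))
  have h2 := lamMax_add_frobPair_le (P.LChi k l t χ) (P.LChi k l t χ')
  have h3 := mul_le_mul_of_nonneg_left (le_sub_iff_add_le'.mpr h2)
    (penaltyDeriv_nonneg (P.one_le_p l) (lamMax (P.LChi k l t χ)))
  rw [inner_gInt hk l ht, add_sub_cancel]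
  linarith

/-- `g` is a subgradient of `h` at every point, also where the largest eigenvalue is multiple. -/
theorem h_add_inner_g_le (hk : k < P.N) (l : P.LIdx) (χ χ' : P.Chi) :
    P.h k l χ + inner ℝ (P.g k l χ) (χ' - χ) ≤ P.h k l χ' := by
  have hg := integrableOn_gInt hk l χ
  rw [h_eq_setIntegral, h_eq_setIntegral, g_eq_setIntegral, real_inner_comm,
    ← integral_inner hg, ← integral_add (integrableOn_penalty_lamMax hk l χ)
      (hg.const_inner (χ' - χ))]
  refine setIntegral_mono_on ((integrableOn_penalty_lamMax hk l χ).add (hg.const_inner (χ' - χ)))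
    (integrableOn_penalty_lamMax hk l χ') measurableSet_Icc fun t ht => ?_
  rw [real_inner_comm]
  exact penalty_lamMax_add_inner_gInt_le hk l ht χ χ'

theorem convexOn_h (hk : k < P.N) (l : P.LIdx) : ConvexOn ℝ univ (P.h k l) := by
  refine ⟨convex_univ, fun x _ y _ a b ha hb hab => ?_⟩
  have hx := mul_le_mul_of_nonneg_left (h_add_inner_g_le hk l (a • x + b • y) x) ha
  have hy := mul_le_mul_of_nonneg_left (h_add_inner_g_le hk l (a • x + b • y) y) hb
  have h0 : a * inner ℝ (P.g k l (a • x + b • y)) (x - (a • x + b • y)) +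
      b * inner ℝ (P.g k l (a • x + b • y)) (y - (a • x + b • y)) = 0 := by
    rw [← real_inner_smul_right, ← real_inner_smul_right, ← inner_add_right]
    have : a • (x - (a • x + b • y)) + b • (y - (a • x + b • y)) = 0 := by
      obtain rfl : b = 1 - a := eq_sub_of_add_eq' hab
      module
    rw [this, inner_zero_right]
  have h1 : a * P.h k l (a • x + b • y) + b * P.h k l (a • x + b • y) =
      P.h k l (a • x + b • y) := by rw [← add_mul, hab, one_mul]
  simp only [smul_eq_mul]
  linarith

theorem continuous_h (hk : k < P.N) (l : P.LIdx) : Continuous (P.h k l) :=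
  continuousOn_univ.mp ((convexOn_h hk l).continuousOn isOpen_univ)

/-! ### Differentiability of `h` at points with a simple largest eigenvalue -/

/-- The matrix inequalities are Lipschitz in the decision variables, uniformly in time. -/
theorem exists_entrySum_LChi_sub_le (hk : k < P.N) (l : P.LIdx) : ∃ c : ℝ, 0 ≤ c ∧
    ∀ t ∈ Icc (P.node k) (P.node (k + 1)), ∀ χ χ' : P.Chi,
      entrySum (P.LChi k l t χ' - P.LChi k l t χ) ≤ c * ‖χ' - χ‖ := by
  have hb := EuclideanSpace.basisFun ((Fin P.nx × Fin P.nx) ⊕ P.ZIdx ⊕ P.ZIdx) ℝ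
  have hM := matBddMeasOn_LChi hk l
  choose R hR using fun c => ((hM (hb c)).sub (hM 0)).exists_entrySum_le
  refine ⟨∑ c, |R c|, Finset.sum_nonneg fun c _ => abs_nonneg _, fun t ht χ χ' => ?_⟩
  -- The increment of an affine function is linear in the increment of its argument.
  have hlin : ∀ i j, P.LChi k l t χ' i j - P.LChi k l t χ i j =
      ∑ c, inner ℝ (hb c) (χ' - χ) * (P.LChi k l t (hb c) i j - P.LChi k l t 0 i j) := by
    intro i j
    obtain ⟨φ, hφ⟩ := (preservesAffineComb_LChi hk l ht i j).exists_linearMap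
    have hφ' : ∀ x, P.LChi k l t x i j = φ x + P.LChi k l t 0 i j := hφ
    have hbasis : ∀ c, P.LChi k l t (hb c) i j - P.LChi k l t 0 i j = φ (hb c) := fun c =>
      sub_eq_iff_eq_add.mpr (hφ' (hb c))
    simp only [hbasis]
    rw [hφ' χ', hφ' χ, add_sub_add_right_eq_sub, ← map_sub]
    conv_lhs => rw [← hb.sum_repr' (χ' - χ)]
    rw [map_sum]
    exact Finset.sum_congr rfl fun c _ => by rw [map_smul, smul_eq_mul]
  have hc : ∀ c, |inner ℝ (hb c) (χ' - χ)| ≤ ‖χ' - χ‖ := fun c => by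
    simpa using abs_real_inner_le_norm (hb c) (χ' - χ)
  have hR' : ∀ c, entrySum (P.LChi k l t (hb c) - P.LChi k l t 0) ≤ |R c| := fun c =>
    (hR c t ht).trans (le_abs_self _)
  calc entrySum (P.LChi k l t χ' - P.LChi k l t χ)
      ≤ ∑ i, ∑ j, ∑ c, ‖χ' - χ‖ * |(P.LChi k l t (hb c) - P.LChi k l t 0) i j| := by
        refine Finset.sum_le_sum fun i _ => Finset.sum_le_sum fun j _ => ?_
        change |P.LChi k l t χ' i j - P.LChi k l t χ i j| ≤ _
        rw [hlin]
        refine (Finset.abs_sum_le_sum_abs _ _).trans (Finset.sum_le_sum fun c _ => ?_)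
        rw [abs_mul]
        exact mul_le_mul_of_nonneg_right (hc c) (abs_nonneg _)
    _ = ∑ c, ‖χ' - χ‖ * entrySum (P.LChi k l t (hb c) - P.LChi k l t 0) := by
        simp only [entrySum, Finset.mul_sum]
        conv_rhs => rw [Finset.sum_comm]
        refine Finset.sum_congr rfl fun i _ => ?_
        rw [Finset.sum_comm]
    _ ≤ ∑ c, ‖χ' - χ‖ * |R c| :=
        Finset.sum_le_sum fun c _ => mul_le_mul_of_nonneg_left (hR' c) (norm_nonneg _)
    _ = (∑ c, |R c|) * ‖χ' - χ‖ := by rw [← Finset.mul_sum, mul_comm]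

theorem hasFDerivAt_lamMax_LChi (hk : k < P.N) (l : P.LIdx) {t : ℝ}
    (ht : t ∈ Icc (P.node k) (P.node (k + 1))) {χ : P.Chi}
    (hsimple : topMult (P.LChi k l t χ) = 1) :
    HasFDerivAt (fun χ' => lamMax (P.LChi k l t χ')) (InnerProductSpace.toDual ℝ P.Chi
      (∑ i, ∑ j, topAvg (P.LChi k l t χ) i j • ∇ (fun ξ : P.Chi => P.LChi k l t ξ i j) χ)) χ := by
  obtain ⟨c, hc⟩ := exists_abs_lamMax_sub_frobPair_le hsimple
  obtain ⟨C, hC0, hC⟩ := exists_entrySum_LChi_sub_le hk l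
  rw [hasFDerivAt_iff_isLittleO, Asymptotics.isLittleO_iff]
  intro δ hδ
  have hlim : Tendsto (fun χ' => √(c * entrySum (P.LChi k l t χ' - P.LChi k l t χ)) * C) (𝓝 χ)
      (𝓝 0) := by
    have h1 : Tendsto (fun χ' => entrySum (P.LChi k l t χ' - P.LChi k l t χ)) (𝓝 χ) (𝓝 0) := by
      refine squeeze_zero (fun _ => entrySum_nonneg _) (fun χ' => hC t ht χ χ') ?_
      have : Continuous fun χ' => C * ‖χ' - χ‖ := by fun_prop
      simpa using this.tendsto χ
    simpa using ((h1.const_mul c).sqrt).mul_const C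
  filter_upwards [hlim.eventually (gt_mem_nhds hδ)] with χ' hχ'
  rw [InnerProductSpace.toDual_apply_apply]
  have hin : inner ℝ (∑ i, ∑ j, topAvg (P.LChi k l t χ) i j •
      ∇ (fun ξ : P.Chi => P.LChi k l t ξ i j) χ) (χ' - χ) =
      frobPair (topAvg (P.LChi k l t χ)) (P.LChi k l t χ' - P.LChi k l t χ) := by
    simp only [real_inner_smul_left, sum_inner, frobPair]
    refine Finset.sum_congr rfl fun i _ => Finset.sum_congr rfl fun j _ => ?_
    rw [(preservesAffineComb_LChi hk l ht i j).inner_gradient, add_sub_cancel]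
    rfl
  rw [hin, Real.norm_eq_abs]
  refine (hc _).trans ((mul_le_mul_of_nonneg_left (hC t ht χ χ') (Real.sqrt_nonneg _)).trans ?_)
  rw [← mul_assoc]
  exact mul_le_mul_of_nonneg_right hχ'.le (norm_nonneg _)

theorem hasFDerivAt_penalty_lamMax_LChi (hk : k < P.N) (l : P.LIdx) (hp : 1 < P.p l) {t : ℝ}
    (ht : t ∈ Icc (P.node k) (P.node (k + 1))) {χ : P.Chi}
    (hsimple : topMult (P.LChi k l t χ) = 1) :
    HasFDerivAt (fun χ' => max 0 (lamMax (P.LChi k l t χ')) ^ P.p l)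
      (InnerProductSpace.toDual ℝ P.Chi (P.gInt k l t χ)) χ := by
  have h := (hasDerivAt_penalty hp (lamMax (P.LChi k l t χ))).comp_hasFDerivAt χ
    (hasFDerivAt_lamMax_LChi hk l ht hsimple)
  refine h.congr_fderiv ?_
  rw [gInt]
  exact ((InnerProductSpace.toDual ℝ P.Chi).map_smul _ _).symm

/-- Differentiation under the integral: simplicity of the largest eigenvalue for almost every time
suffices, as the integrand is locally Lipschitz in `χ` uniformly in time. -/
theorem hasGradientAt_h (hk : k < P.N) (l : P.LIdx) (hp : 1 < P.p l) {χ : P.Chi}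
    (hsimple : ∀ᵐ t ∂(volume.restrict (Icc (P.node k) (P.node (k + 1)))),
      topMult (P.LChi k l t χ) = 1) :
    HasGradientAt (P.h k l) (P.g k l χ) χ := by
  set μ := volume.restrict (Icc (P.node k) (P.node (k + 1))) with hμ
  obtain ⟨C, hC0, hC⟩ := exists_entrySum_LChi_sub_le hk l
  obtain ⟨R, hR⟩ := (matBddMeasOn_LChi hk l χ).exists_entrySum_le
  have hmem : ∀ᵐ t ∂μ, t ∈ Icc (P.node k) (P.node (k + 1)) :=
    (ae_restrict_iff' measurableSet_Icc).mpr (ae_of_all _ fun _ h => h)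
  have hg : Integrable (fun t => P.gInt k l t χ) μ := integrableOn_gInt hk l χ
  let D : P.Chi →L[ℝ] (P.Chi →L[ℝ] ℝ) :=
    (InnerProductSpace.toDual ℝ P.Chi).toContinuousLinearEquiv.toContinuousLinearMap
  have hbd : ∀ t ∈ Icc (P.node k) (P.node (k + 1)), ∀ χ' ∈ Metric.ball χ 1,
      |lamMax (P.LChi k l t χ')| ≤ |R| + C := by
    intro t ht χ' hχ'
    have h1 := abs_lamMax_sub_le (P.LChi k l t χ) (P.LChi k l t χ')
    have h2 := hC t ht χ χ'
    have h3 : C * ‖χ' - χ‖ ≤ C * 1 :=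
      mul_le_mul_of_nonneg_left (mem_ball_iff_norm.mp hχ').le hC0
    have h4 := (abs_lamMax_le (P.LChi k l t χ)).trans ((hR t ht).trans (le_abs_self R))
    have h5 := abs_sub_abs_le_abs_sub (lamMax (P.LChi k l t χ')) (lamMax (P.LChi k l t χ))
    linarith
  have hderiv := hasFDerivAt_integral_of_dominated_loc_of_lip (μ := μ) (𝕜 := ℝ) (x₀ := χ)
    (F := fun χ' t => max 0 (lamMax (P.LChi k l t χ')) ^ P.p l)
    (F' := fun t => D (P.gInt k l t χ))
    (bound := fun _ => P.p l * (|R| + C) ^ (P.p l - 1) * C)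
    (Metric.ball_mem_nhds χ one_pos)
    (Eventually.of_forall fun χ' => (integrableOn_penalty_lamMax hk l χ').aestronglyMeasurable)
    (integrableOn_penalty_lamMax hk l χ)
    (D.continuous.comp_aestronglyMeasurable hg.aestronglyMeasurable)
    (by
      filter_upwards [hmem] with t ht
      refine LipschitzOnWith.of_dist_le_mul fun x hx y hy => ?_
      have hp0 : 0 ≤ P.p l * (|R| + C) ^ (P.p l - 1) := by positivity
      rw [Real.dist_eq, dist_eq_norm, Real.coe_nnabs, abs_of_nonneg (mul_nonneg hp0 hC0), mul_assoc]
      refine (abs_penalty_sub_le (P.one_le_p l) (hbd t ht y hy) (hbd t ht x hx)).trans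
        (mul_le_mul_of_nonneg_left ?_ hp0)
      exact (abs_lamMax_sub_le _ _).trans (hC t ht y x))
    (integrable_const _)
    (by
      filter_upwards [hmem, hsimple] with t ht hs
      exact hasFDerivAt_penalty_lamMax_LChi hk l hp ht hs)
  rw [ContinuousLinearMap.integral_comp_comm D hg] at hderiv
  rw [hasGradientAt_iff_hasFDerivAt, g_eq_setIntegral, funext (P.h_eq_setIntegral k l)]
  exact hderiv.2

end FunnelProblem

/-! ### The feasible set is convex and, apart from the domain of the cost, closed -/

/-- A cone whose generators have disjoint supports is closed. -/
theorem isClosed_disjoint_cone {ι κ : Type*} (c : ι → κ) (w : ι → ℝ) :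
    IsClosed {x : ι → ℝ | ∃ lam : κ → ℝ, (∀ i, 0 ≤ lam i) ∧ ∀ j, x j = lam (c j) * w j} := by
  have h : {x : ι → ℝ | ∃ lam : κ → ℝ, (∀ i, 0 ≤ lam i) ∧ ∀ j, x j = lam (c j) * w j} =
      ⋂ i, {x : ι → ℝ | ∃ a : ℝ, 0 ≤ a ∧ ∀ j, c j = i → x j = a * w j} := by
    ext x
    simp only [mem_ofPred_eq, mem_iInter]
    constructor
    · rintro ⟨lam, h0, h⟩ i
      exact ⟨lam i, h0 i, fun j hj => by rw [h j, hj]⟩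
    · intro h
      choose lam h0 h using h
      exact ⟨lam, h0, fun j => h (c j) j rfl⟩
  rw [h]
  refine isClosed_iInter fun i => ?_
  by_cases hw : ∃ j, c j = i ∧ w j ≠ 0
  · -- The coefficient of the generator is determined by a coordinate in its support.
    obtain ⟨j₀, hj₀, hw⟩ := hw
    have h' : {x : ι → ℝ | ∃ a : ℝ, 0 ≤ a ∧ ∀ j, c j = i → x j = a * w j} =
        {x | 0 ≤ x j₀ / w j₀} ∩ ⋂ j, ⋂ _ : c j = i, {x | x j = x j₀ / w j₀ * w j} := by
      ext x
      simp only [mem_ofPred_eq, mem_inter_iff, mem_iInter]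
      constructor
      · rintro ⟨a, ha, h⟩
        have : x j₀ / w j₀ = a := by rw [h j₀ hj₀, mul_div_cancel_right₀ _ hw]
        rw [this]
        exact ⟨ha, h⟩
      · exact fun h => ⟨_, h.1, h.2⟩
    rw [h']
    refine (isClosed_le continuous_const (by fun_prop)).inter
      (isClosed_iInter fun j => isClosed_iInter fun _ => isClosed_eq (by fun_prop) (by fun_prop))
  · push Not at hw
    have h' : {x : ι → ℝ | ∃ a : ℝ, 0 ≤ a ∧ ∀ j, c j = i → x j = a * w j} =
        ⋂ j, ⋂ _ : c j = i, {x | x j = 0} := by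
      ext x
      simp only [mem_ofPred_eq, mem_iInter]
      constructor
      · rintro ⟨a, ha, h⟩ j hj
        rw [h j hj, hw j hj, mul_zero]
      · exact fun h => ⟨0, le_rfl, fun j hj => by rw [h j hj, zero_mul]⟩
    rw [h']
    exact isClosed_iInter fun j => isClosed_iInter fun _ =>
      isClosed_eq (by fun_prop) continuous_const

theorem isClosed_setOf_forall {X ι : Type*} [TopologicalSpace X] {p : ι → X → Prop}
    (h : ∀ i, IsClosed {x | p i x}) : IsClosed {x | ∀ i, p i x} := by
  rw [ofPred_forall]
  exact isClosed_iInter h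

theorem isClosed_setOf_posSemidef {n : Type*} [Fintype n] :
    IsClosed {M : Matrix n n ℝ | M.PosSemidef} := by
  simp only [Matrix.posSemidef_iff_dotProduct_mulVec, ofPred_and]
  refine IsClosed.inter ?_
    (isClosed_setOf_forall fun x => isClosed_le continuous_const (by fun_prop))
  exact isClosed_eq (by fun_prop) continuous_id

namespace MultiplierClass

variable {nq np : ℕ}

theorem Admissible.comb {m : MultiplierClass nq np} {t : ℝ} {N₁ N₁' : Matrix (Fin nq) (Fin nq) ℝ}
    {N₂ N₂' : Matrix (Fin np) (Fin np) ℝ} {σ σ' : Fin m.ns → ℝ} (h : m.Admissible t N₁ N₂ σ)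
    (h' : m.Admissible t N₁' N₂' σ') {r s : ℝ} (hr : 0 ≤ r) (hs : 0 ≤ s) (hrs : r + s = 1) :
    m.Admissible t (r • N₁ + s • N₁') (r • N₂ + s • N₂') (r • σ + s • σ') := by
  cases m with
  | sector S₁ S₂ =>
    obtain ⟨lam, h0, rfl, rfl⟩ := h
    obtain ⟨lam', h0', rfl, rfl⟩ := h'
    exact ⟨r * lam + s * lam', by positivity, by module, by module⟩
  | lipschitz nc cq cp γ =>
    obtain ⟨lam, h0, rfl, rfl⟩ := h
    obtain ⟨lam', h0', rfl, rfl⟩ := h'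
    refine ⟨fun i => r * lam i + s * lam' i, fun i => ?_, ?_, ?_⟩
    · have := h0 i
      have := h0' i
      positivity
    · ext i j
      by_cases hij : i = j <;> simp [hij]
    · ext i j
      by_cases hij : i = j <;> simp [hij]
      ring
  | lSmooth nc cq cp β lam =>
    obtain ⟨h0, rfl, rfl⟩ := h
    obtain ⟨h0', rfl, rfl⟩ := h'
    refine ⟨fun i => ?_, ?_, ?_⟩
    · exact add_nonneg (mul_nonneg hr (h0 i)) (mul_nonneg hs (h0' i))
    · rw [← add_smul, hrs, one_smul]
    · have hσ : ∀ i : Fin nc, (r • σ + s • σ') i = r * σ i + s * σ' i := fun i => rfl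
      ext i j
      by_cases hij : i = j <;> simp [hij, hσ]
      ring
  | convexSet 𝒩 convex closed =>
    exact convex t h h' hr hs hrs

theorem isClosed_setOf_admissible (m : MultiplierClass nq np) (t : ℝ) :
    IsClosed {x : Matrix (Fin nq) (Fin nq) ℝ × Matrix (Fin np) (Fin np) ℝ × (Fin m.ns → ℝ) |
      m.Admissible t x.1 x.2.1 x.2.2} := by
  let e : ∀ m : MultiplierClass nq np,
      Matrix (Fin nq) (Fin nq) ℝ × Matrix (Fin np) (Fin np) ℝ × (Fin m.ns → ℝ) →
      (Fin nq × Fin nq) ⊕ (Fin np × Fin np) → ℝ := fun m x =>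
    Sum.elim (fun p => x.1 p.1 p.2) fun p => x.2.1 p.1 p.2
  have he : ∀ m, Continuous (e m) := fun m => by
    refine continuous_pi fun j => ?_
    rcases j with j | j
    · exact continuous_fst.matrix_elem j.1 j.2
    · exact (continuous_fst.comp continuous_snd).matrix_elem j.1 j.2
  cases m with
  | sector S₁ S₂ =>
    convert (isClosed_disjoint_cone (fun _ => ())
      (Sum.elim (fun p : Fin nq × Fin nq => S₁ p.1 p.2) fun p : Fin np × Fin np => S₂ p.1 p.2)
      ).preimage (he (sector S₁ S₂)) using 1
    ext x
    simp only [mem_ofPred_eq, mem_preimage, Sum.forall, Prod.forall]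
    constructor
    · rintro ⟨lam, h0, h₁, h₂⟩
      exact ⟨fun _ => lam, fun _ => h0, fun i j => congrFun (congrFun h₁ i) j,
        fun i j => congrFun (congrFun h₂ i) j⟩
    · rintro ⟨lam, h0, h₁, h₂⟩
      exact ⟨lam (), h0 _, Matrix.ext h₁, Matrix.ext h₂⟩
  | lipschitz nc cq cp γ =>
    convert (isClosed_disjoint_cone
      (Sum.elim (fun p : Fin nq × Fin nq => cq p.1) fun p : Fin np × Fin np => cp p.1)
      (Sum.elim (fun p : Fin nq × Fin nq => if p.1 = p.2 then (1 : ℝ) else 0)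
        fun p : Fin np × Fin np => if p.1 = p.2 then γ t (cp p.1) ^ 2 else 0)
      ).preimage (he (lipschitz nc cq cp γ)) using 1
    ext x
    simp only [mem_ofPred_eq, mem_preimage, Sum.forall, Prod.forall]
    refine exists_congr fun lam => and_congr_right fun _ => and_congr ?_ ?_
    · rw [← Matrix.ext_iff]
      simp [e, Matrix.diagonal_apply]
    · rw [← Matrix.ext_iff]
      simp [e, Matrix.diagonal_apply]
  | lSmooth nc cq cp β lam =>
    have hs : ∀ i, Continuous fun x : Matrix (Fin nq) (Fin nq) ℝ × Matrix (Fin np) (Fin np) ℝ ×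
        (Fin nc → ℝ) => x.2.2 i := fun i => by fun_prop
    refine IsClosed.inter 
      (s₁ := {x : Matrix (Fin nq) (Fin nq) ℝ × Matrix (Fin np) (Fin np) ℝ × (Fin nc → ℝ) |
        ∀ i, 0 ≤ x.2.2 i}) ?_
      (IsClosed.inter (isClosed_eq continuous_fst continuous_const)
        (isClosed_eq (continuous_fst.comp continuous_snd) ?_))
    · exact isClosed_setOf_forall fun i => isClosed_le continuous_const (hs i)
    · exact Continuous.matrix_diagonal (continuous_pi fun b =>
        (continuous_const.mul (hs (cp b))).mul continuous_const)
  | convexSet 𝒩 convex closed =>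
    exact (closed t).preimage (continuous_fst.prodMk (continuous_fst.comp continuous_snd))

end MultiplierClass

namespace FunnelProblem

variable {P : FunnelProblem}

theorem NodeFeasible.comb {t : ℝ} {Q Q' : Matrix (Fin P.nx) (Fin P.nx) ℝ} {ζ ζ' : P.Zeta}
    (h : P.NodeFeasible t Q ζ) (h' : P.NodeFeasible t Q' ζ') {r s : ℝ} (hr : 0 ≤ r) (hs : 0 ≤ s)
    (hrs : r + s = 1) : P.NodeFeasible t (r • Q + s • Q') (r • ζ + s • ζ') := by
  obtain ⟨hQ, hZ, hN₁, hN₂, hL, hA, hl0, hlα⟩ := h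
  obtain ⟨hQ', hZ', hN₁', hN₂', hL', hA', hl0', hlα'⟩ := h'
  refine ⟨(hQ.smul r).add (hQ'.smul s), ?_, ?_, ?_, fun l => ?_, ?_, ?_, ?_⟩
  · rw [Zeta.Z_comb]
    exact (hZ.smul r).add (hZ'.smul s)
  · rw [Zeta.N₁_comb]
    exact (hN₁.smul r).add (hN₁'.smul s)
  · rw [Zeta.N₂_comb]
    exact (hN₂.smul r).add (hN₂'.smul s)
  · rw [LMI_comb l t hrs, neg_add, ← smul_neg, ← smul_neg]
    exact ((hL l).smul hr).add ((hL' l).smul hs)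
  · rw [Zeta.N₁_comb, Zeta.N₂_comb, Zeta.s_comb]
    exact hA.comb hA' hr hs hrs
  · rw [Zeta.lamW_comb]
    positivity
  · rw [Zeta.lamW_comb]
    calc r * ζ.lamW + s * ζ'.lamW ≤ r * P.α + s * P.α := by gcongr
      _ = P.α := by rw [← add_mul, hrs, one_mul]

theorem Qnode_comb (r s : ℝ) (z z' : P.Dec) (k : ℕ) :
    P.Qnode (r • z + s • z') k = r • P.Qnode z k + s • P.Qnode z' k := by
  unfold Qnode
  split_ifs
  · rw [← mat_comb, ← Chi.q_comb]
    rfl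
  · rw [← mat_comb]
    rfl

/-- The base constraints define a convex set. -/
theorem BaseFeasible.comb {z z' : P.Dec} (h : P.BaseFeasible z) (h' : P.BaseFeasible z') {r s : ℝ}
    (hr : 0 ≤ r) (hs : 0 ≤ s) (hrs : r + s = 1) : P.BaseFeasible (r • z + s • z') := by
  obtain ⟨hd, hm, hp, hf, hJ⟩ := h
  obtain ⟨hd', hm', hp', hf', hJ'⟩ := h'
  have hz : ∀ k, (r • z + s • z').1 k = r • z.1 k + s • z'.1 k := fun k => rfl
  refine ⟨fun k => ?_, fun k => ?_, fun k => ?_, ?_, ?_⟩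
  · rw [Qnode_comb, hz, path_comb k.2 r s _ _ ⟨(P.node_lt_node_succ k).le, le_rfl⟩, hd k, hd' k]
  · rw [Qnode_comb, hz, Chi.ζm_comb]
    exact (hm k).comb (hm' k) hr hs hrs
  · rw [Qnode_comb, hz, Chi.ζp_comb]
    exact (hp k).comb (hp' k) hr hs hrs
  · have hsplit : P.Qf - (r • P.Qnode z P.N + s • P.Qnode z' P.N) =
        r • (P.Qf - P.Qnode z P.N) + s • (P.Qf - P.Qnode z' P.N) := by
      obtain rfl : s = 1 - r := eq_sub_of_add_eq' hrs
      module
    rw [Qnode_comb, hsplit]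
    exact (hf.smul hr).add (hf'.smul hs)
  · rw [Qnode_comb]
    exact P.convex_J.1 hJ hJ' hr hs hrs

theorem continuous_matrix_of_preservesAffineComb {V m n : Type*} [NormedAddCommGroup V]
    [NormedSpace ℝ V] [FiniteDimensional ℝ V] {f : V → Matrix m n ℝ}
    (hf : PreservesAffineComb f) : Continuous f :=
  continuous_matrix fun i j => PreservesAffineComb.continuous (f := fun x => f x i j)
    fun r s hrs x y => congrArg (fun M : Matrix m n ℝ => M i j) (hf r s hrs x y)

theorem continuous_Qnode (P : FunnelProblem) (k : ℕ) : Continuous fun z => P.Qnode z k :=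
  continuous_matrix_of_preservesAffineComb fun r s _ z z' => Qnode_comb r s z z' k

theorem isClosed_setOf_nodeFeasible {X : Type*} [NormedAddCommGroup X] [NormedSpace ℝ X]
    [FiniteDimensional ℝ X] (t : ℝ) {Q : X → Matrix (Fin P.nx) (Fin P.nx) ℝ} {ζ : X → P.Zeta}
    (hQ : PreservesAffineComb Q) (hζ : PreservesAffineComb ζ) (hζc : Continuous ζ) :
    IsClosed {x | P.NodeFeasible t (Q x) (ζ x)} := by
  have hQc := continuous_matrix_of_preservesAffineComb hQ
  have hc : ∀ c, Continuous fun x => ζ x c := fun c =>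
    (EuclideanSpace.proj (𝕜 := ℝ) c).continuous.comp hζc
  have hZ : Continuous fun x => (ζ x).Z := continuous_matrix fun i j => hc _
  have hN₁ : Continuous fun x => (ζ x).N₁ := continuous_matrix fun i j => hc _
  have hN₂ : Continuous fun x => (ζ x).N₂ := continuous_matrix fun i j => hc _
  have hs : Continuous fun x => (ζ x).s := continuous_pi fun i => hc _
  have hL : ∀ l, Continuous fun x => P.LMI l t (Q x) (ζ x) := fun l =>
    continuous_matrix_of_preservesAffineComb fun r s hrs x y => by
      rw [hQ r s hrs, hζ r s hrs, LMI_comb l t hrs]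
  refine (isClosed_eq hQc.matrix_transpose hQc).inter <|
    (isClosed_eq hZ.matrix_transpose hZ).inter <|
    (isClosed_eq hN₁.matrix_transpose hN₁).inter <|
    (isClosed_eq hN₂.matrix_transpose hN₂).inter <| IsClosed.inter ?_ <|
    ((P.mult.isClosed_setOf_admissible t).preimage (hN₁.prodMk (hN₂.prodMk hs))).inter <|
    (isClosed_le continuous_const (hc _)).inter (isClosed_le (hc _) continuous_const)
  exact isClosed_setOf_forall fun l => isClosed_setOf_posSemidef.preimage (hL l).neg

/-- The base constraints without the domain of the cost define a closed set. -/
theorem isClosed_setOf_constraints (P : FunnelProblem) : IsClosed {z : P.Dec |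
    (∀ k : Fin P.N, P.Qnode z (k + 1) = P.path k (z.1 k) (P.node (k + 1))) ∧
    (∀ k : Fin P.N, P.NodeFeasible (P.node k) (P.Qnode z k) (Chi.ζm (z.1 k))) ∧
    (∀ k : Fin P.N, P.NodeFeasible (P.node (k + 1)) (P.Qnode z (k + 1)) (Chi.ζp (z.1 k))) ∧
    (P.Qf - P.Qnode z P.N).PosSemidef} := by
  have hcoord : ∀ (k : Fin P.N) (c), Continuous fun z : P.Dec => z.1 k c := fun k c => by fun_prop
  refine IsClosed.inter ?_ (IsClosed.inter ?_ (IsClosed.inter ?_ ?_))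
  · refine isClosed_setOf_forall fun k => isClosed_eq (P.continuous_Qnode _) ?_
    exact continuous_matrix_of_preservesAffineComb fun r s _ z z' =>
      path_comb k.2 r s _ _ ⟨(P.node_lt_node_succ k).le, le_rfl⟩
  · refine isClosed_setOf_forall fun k => isClosed_setOf_nodeFeasible _
      (fun r s _ z z' => Qnode_comb r s z z' k) (fun r s _ z z' => Chi.ζm_comb r s _ _) ?_
    exact (PiLp.continuous_toLp 2 _).comp (continuous_pi fun c => hcoord k _)
  · refine isClosed_setOf_forall fun k => isClosed_setOf_nodeFeasible _
      (fun r s _ z z' => Qnode_comb r s z z' (k + 1)) (fun r s _ z z' => Chi.ζp_comb r s _ _) ?_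
    exact (PiLp.continuous_toLp 2 _).comp (continuous_pi fun c => hcoord k _)
  · exact isClosed_setOf_posSemidef.preimage (continuous_const.sub (P.continuous_Qnode _))

end FunnelProblem

/-! ### The descent inequality for Lipschitz subgradients -/

/-- A function with a subgradient selection that is Lipschitz along the segment from `x` to
`x + d` satisfies the descent inequality; no differentiability is needed. -/
theorem le_add_inner_add_of_subgradient {E : Type*} [NormedAddCommGroup E] [InnerProductSpace ℝ E]
    {f : E → ℝ} {g : E → E} (hsub : ∀ x y, f x + inner ℝ (g x) (y - x) ≤ f y) {x d : E} {β : ℝ}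
    (hL : ∀ s ∈ Icc (0 : ℝ) 1, ‖g (x + s • d) - g x‖ ≤ β * ‖s • d‖) :
    f (x + d) ≤ f x + inner ℝ (g x) d + β / 2 * ‖d‖ ^ 2 := by
  -- Sum the subgradient inequalities over an equidistant partition into `n + 1` parts.
  have hstep : ∀ n j : ℕ, j ≤ n + 1 → f (x + ((j : ℝ) / (n + 1)) • d) ≤
      f x + (j : ℝ) / (n + 1) * inner ℝ (g x) d
        + β * ‖d‖ ^ 2 * ((j : ℝ) * (j + 1) / (2 * (n + 1) ^ 2)) := by
    intro n j
    induction j with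
    | zero => simp
    | succ j ih =>
      intro hj
      have ih := ih (by omega)
      have hn : (0 : ℝ) < n + 1 := by positivity
      set τ : ℝ := ((j + 1 : ℕ) : ℝ) / (n + 1) with hτ
      have hτ0 : 0 ≤ τ := by positivity
      have hτ1 : τ ≤ 1 := (div_le_one hn).mpr (by exact_mod_cast hj)
      have h1 := hsub (x + τ • d) (x + ((j : ℝ) / (n + 1)) • d)
      have hd : x + ((j : ℝ) / (n + 1)) • d - (x + τ • d) = (-(1 / ((n : ℝ) + 1))) • d := by
        rw [add_sub_add_left_eq_sub, ← sub_smul, hτ]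
        congr 1
        push_cast
        ring
      rw [hd, real_inner_smul_right] at h1
      have h2 : inner ℝ (g (x + τ • d)) d ≤ inner ℝ (g x) d + β * τ * ‖d‖ ^ 2 := by
        have h3 := real_inner_le_norm (g (x + τ • d) - g x) d
        have h4 := mul_le_mul_of_nonneg_right (hL τ ⟨hτ0, hτ1⟩) (norm_nonneg d)
        rw [inner_sub_left] at h3
        rw [norm_smul, Real.norm_of_nonneg hτ0] at h4
        nlinarith
      have h5 := mul_le_mul_of_nonneg_left h2 (one_div_pos.mpr hn).le
      have hsum : f (x + τ • d) ≤ f x + (j : ℝ) / (n + 1) * inner ℝ (g x) d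
          + β * ‖d‖ ^ 2 * ((j : ℝ) * (j + 1) / (2 * (n + 1) ^ 2))
          + 1 / ((n : ℝ) + 1) * (inner ℝ (g x) d + β * τ * ‖d‖ ^ 2) := by linarith
      refine hsum.trans_eq ?_
      rw [hτ]
      push_cast
      field_simp
      ring
  have hn : ∀ n : ℕ, f (x + d) ≤
      f x + inner ℝ (g x) d + β / 2 * ‖d‖ ^ 2 * (1 + 1 / ((n : ℝ) + 1)) := fun n => by
    have hn : ((n : ℝ) + 1) ≠ 0 := by positivity
    have h := hstep n (n + 1) le_rfl
    push_cast at h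
    rw [div_self hn, one_smul, one_mul] at h
    refine h.trans_eq ?_
    field_simp
  refine ge_of_tendsto' (x := (atTop : Filter ℕ)) ?_ hn
  have h := ((tendsto_one_div_add_atTop_nhds_zero_nat (𝕜 := ℝ)).const_add 1).const_mul
    (β / 2 * ‖d‖ ^ 2)
  simpa using h.const_add (f x + inner ℝ (g x) d)

namespace FunnelProblem

variable (P : FunnelProblem)

/-! ### The penalized problem -/

/-- The total violation of the relaxed continuous-time constraints. -/
def violation (z : P.Dec) : ℝ := ∑ k : Fin P.N, ∑ l : P.LIdx, max 0 (P.h k l (z.1 k) - P.ε)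

/-- The exact penalty function. -/
def penObj (wh : ℝ) (z : P.Dec) : ℝ := P.J (P.Qnode z 0) + wh * P.violation z

/-- The squared Euclidean distance of the proximal term. -/
def sqDist (y z : P.Dec) : ℝ := ∑ k : Fin P.N, ‖y.1 k - z.1 k‖ ^ 2 + ‖y.2 - z.2‖ ^ 2

variable {P} {wh wtr : ℝ}

theorem violation_nonneg (z : P.Dec) : 0 ≤ P.violation z :=
  Finset.sum_nonneg fun _ _ => Finset.sum_nonneg fun _ _ => le_max_left _ _

theorem h_sub_le_violation (z : P.Dec) (k : Fin P.N) (l : P.LIdx) :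
    P.h k l (z.1 k) - P.ε ≤ P.violation z :=
  (le_max_right 0 _).trans <|
    (Finset.single_le_sum (f := fun l => max 0 (P.h k l (z.1 k) - P.ε))
      (fun _ _ => le_max_left _ _) (Finset.mem_univ l)).trans
    (Finset.single_le_sum (f := fun k : Fin P.N => ∑ l, max 0 (P.h k l (z.1 k) - P.ε))
      (fun _ _ => Finset.sum_nonneg fun _ _ => le_max_left _ _) (Finset.mem_univ k))

theorem MainFeasible.violation_eq_zero {z : P.Dec} (hz : P.MainFeasible z) :
    P.violation z = 0 :=
  Finset.sum_eq_zero fun k _ => Finset.sum_eq_zero fun l _ =>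
    max_eq_left (sub_nonpos.mpr (hz.2 k l))

theorem BaseFeasible.mainFeasible {z : P.Dec} (hz : P.BaseFeasible z) (h : P.violation z ≤ 0) :
    P.MainFeasible z :=
  ⟨hz, fun k l => by linarith [h_sub_le_violation z k l]⟩

theorem continuous_violation (P : FunnelProblem) : Continuous P.violation := by
  refine continuous_finsetSum _ fun k _ => continuous_finsetSum _ fun l _ => ?_
  have : Continuous fun z : P.Dec => P.h k l (z.1 k) :=
    (continuous_h k.2 l).comp ((continuous_apply k).comp continuous_fst)
  fun_prop

theorem sqDist_nonneg (y z : P.Dec) : 0 ≤ P.sqDist y z := by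
  unfold sqDist
  positivity

theorem sqDist_self (z : P.Dec) : P.sqDist z z = 0 := by simp [sqDist]

theorem continuous_sqDist_left (y : P.Dec) : Continuous fun z => P.sqDist y z := by
  unfold sqDist
  fun_prop

theorem dist_le_sqrt_sqDist (y z : P.Dec) : dist z y ≤ √(P.sqDist y z) := by
  have hk : ∀ k, ‖y.1 k - z.1 k‖ ^ 2 ≤ ∑ k : Fin P.N, ‖y.1 k - z.1 k‖ ^ 2 := fun k =>
    Finset.single_le_sum (f := fun k : Fin P.N => ‖y.1 k - z.1 k‖ ^ 2)
      (fun _ _ => sq_nonneg _) (Finset.mem_univ k)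
  have hs : 0 ≤ ∑ k : Fin P.N, ‖y.1 k - z.1 k‖ ^ 2 := Finset.sum_nonneg fun _ _ => sq_nonneg _
  rw [dist_comm, Prod.dist_eq, max_le_iff]
  refine ⟨(dist_pi_le_iff (Real.sqrt_nonneg _)).mpr fun k => ?_, ?_⟩
  · rw [dist_eq_norm]
    exact Real.le_sqrt_of_sq_le (by unfold sqDist; linarith [hk k, sq_nonneg ‖y.2 - z.2‖])
  · rw [dist_eq_norm]
    exact Real.le_sqrt_of_sq_le (by unfold sqDist; linarith)

theorem norm_comb_sub_sq {E : Type*} [NormedAddCommGroup E] [InnerProductSpace ℝ E] {r s : ℝ}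
    (hrs : r + s = 1) (x y z : E) : ‖r • x + s • y - z‖ ^ 2 =
      r * ‖x - z‖ ^ 2 + s * ‖y - z‖ ^ 2 - r * s * ‖y - x‖ ^ 2 := by
  have h1 : r • x + s • y - z = r • (x - z) + s • (y - z) := by
    obtain rfl : s = 1 - r := eq_sub_of_add_eq' hrs
    module
  have h2 : y - x = (y - z) - (x - z) := by abel
  rw [h1, h2, norm_add_sq_real, norm_sub_sq_real (y - z), norm_smul, norm_smul, mul_pow, mul_pow,
    real_inner_smul_left, real_inner_smul_right, real_inner_comm, Real.norm_eq_abs,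
    Real.norm_eq_abs, sq_abs, sq_abs]
  obtain rfl : s = 1 - r := eq_sub_of_add_eq' hrs
  ring

theorem sqDist_comb {r s : ℝ} (hrs : r + s = 1) (x y z : P.Dec) :
    P.sqDist (r • x + s • y) z =
      r * P.sqDist x z + s * P.sqDist y z - r * s * P.sqDist y x := by
  have h1 : ∀ k, ‖(r • x + s • y).1 k - z.1 k‖ ^ 2 = r * ‖x.1 k - z.1 k‖ ^ 2
      + s * ‖y.1 k - z.1 k‖ ^ 2 - r * s * ‖y.1 k - x.1 k‖ ^ 2 := fun k =>
    norm_comb_sub_sq hrs (x.1 k) (y.1 k) (z.1 k)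
  have h2 : ‖(r • x + s • y).2 - z.2‖ ^ 2 = r * ‖x.2 - z.2‖ ^ 2
      + s * ‖y.2 - z.2‖ ^ 2 - r * s * ‖y.2 - x.2‖ ^ 2 := norm_comb_sub_sq hrs x.2 y.2 z.2
  unfold sqDist
  simp only [h1, h2, Finset.sum_sub_distrib, Finset.sum_add_distrib, ← Finset.mul_sum]
  ring

theorem J_comb_le {x y : P.Dec} (hx : P.BaseFeasible x) (hy : P.BaseFeasible y) {r s : ℝ}
    (hr : 0 ≤ r) (hs : 0 ≤ s) (hrs : r + s = 1) : P.J (P.Qnode (r • x + s • y) 0) ≤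
      r * P.J (P.Qnode x 0) + s * P.J (P.Qnode y 0) := by
  rw [Qnode_comb]
  exact P.convex_J.2 hx.2.2.2.2 hy.2.2.2.2 hr hs hrs

/-! ### One step of the SCvx method is a proximal step for the penalized problem -/

theorem linViol_comb {r s : ℝ} (hrs : r + s = 1) (zb x y : P.Dec) (k : Fin P.N) (l : P.LIdx) :
    P.linViol zb (r • x + s • y) k l = r * P.linViol zb x k l + s * P.linViol zb y k l := by
  have h : (r • x + s • y).1 k - zb.1 k = r • (x.1 k - zb.1 k) + s • (y.1 k - zb.1 k) := by
    obtain rfl : s = 1 - r := eq_sub_of_add_eq' hrs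
    change r • x.1 k + (1 - r) • y.1 k - zb.1 k = _
    module
  unfold linViol
  rw [h, inner_add_right, real_inner_smul_right, real_inner_smul_right]
  obtain rfl : s = 1 - r := eq_sub_of_add_eq' hrs
  ring

theorem subObj_comb_le (hwh : 0 ≤ wh) (zb : P.Dec) {x y : P.Dec}
    (hx : P.BaseFeasible x) (hy : P.BaseFeasible y) {r s : ℝ} (hr : 0 ≤ r) (hs : 0 ≤ s)
    (hrs : r + s = 1) : P.subObj wh wtr zb (r • x + s • y) ≤
      r * P.subObj wh wtr zb x + s * P.subObj wh wtr zb y - wtr * (r * s * P.sqDist y x) := by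
  have hJ := J_comb_le hx hy hr hs hrs
  have hviol : ∑ k : Fin P.N, ∑ l : P.LIdx, max 0 (P.linViol zb (r • x + s • y) k l) ≤
      r * ∑ k : Fin P.N, ∑ l : P.LIdx, max 0 (P.linViol zb x k l) +
        s * ∑ k : Fin P.N, ∑ l : P.LIdx, max 0 (P.linViol zb y k l) := by
    simp only [Finset.mul_sum, ← Finset.sum_add_distrib]
    refine Finset.sum_le_sum fun k _ => Finset.sum_le_sum fun l _ => ?_
    rw [linViol_comb hrs]
    refine max_le ?_ ?_
    · have := le_max_left 0 (P.linViol zb x k l)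
      have := le_max_left 0 (P.linViol zb y k l)
      positivity
    · gcongr <;> exact le_max_right _ _
  have hD := sqDist_comb hrs x y zb
  have hviol' := mul_le_mul_of_nonneg_left hviol hwh
  change P.J _ + wh * _ + wtr * P.sqDist _ _ ≤ r * (P.J _ + wh * _ + wtr * P.sqDist _ _) +
    s * (P.J _ + wh * _ + wtr * P.sqDist _ _) - _
  rw [hD]
  linarith

/-- Quadratic growth of the strongly convex subproblem at its minimizer. -/
theorem IsSubSolution.add_sqDist_le (hwh : 0 ≤ wh) {zb x y : P.Dec}
    (hx : P.IsSubSolution wh wtr zb x) (hy : P.BaseFeasible y) :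
    P.subObj wh wtr zb x + wtr * P.sqDist y x ≤ P.subObj wh wtr zb y := by
  -- Compare with the points `x + s (y - x)` and let `s` tend to `0`.
  have hs : ∀ s ∈ Ioo (0 : ℝ) 1, P.subObj wh wtr zb x + wtr * (1 - s) * P.sqDist y x ≤
      P.subObj wh wtr zb y := by
    rintro s ⟨hs0, hs1⟩
    have h1 := hx.2 _ (hx.1.comb hy (sub_nonneg.mpr hs1.le) hs0.le (by ring))
    have h2 := subObj_comb_le (wtr := wtr) hwh zb hx.1 hy (sub_nonneg.mpr hs1.le) hs0.le (by ring)
    have h3 : s * (P.subObj wh wtr zb x + wtr * (1 - s) * P.sqDist y x) ≤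
        s * P.subObj wh wtr zb y := by linarith
    exact le_of_mul_le_mul_left h3 hs0
  have hlim : Tendsto (fun s : ℝ => P.subObj wh wtr zb x + wtr * (1 - s) * P.sqDist y x) (𝓝[>] 0)
      (𝓝 (P.subObj wh wtr zb x + wtr * P.sqDist y x)) := by
    have : Continuous fun s : ℝ => P.subObj wh wtr zb x + wtr * (1 - s) * P.sqDist y x := by
      fun_prop
    simpa using (this.tendsto 0).mono_left nhdsWithin_le_nhds
  refine le_of_tendsto hlim ?_
  filter_upwards [Ioo_mem_nhdsGT one_pos] with s hs' using hs s hs'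

theorem subObj_le_penObj_add (hwh : 0 ≤ wh) (zb y : P.Dec) :
    P.subObj wh wtr zb y ≤ P.penObj wh y + wtr * P.sqDist y zb := by
  have h : ∑ k : Fin P.N, ∑ l : P.LIdx, max 0 (P.linViol zb y k l) ≤ P.violation y :=
    Finset.sum_le_sum fun k _ => Finset.sum_le_sum fun l _ => max_le_max_left 0
      (sub_le_sub_right (h_add_inner_g_le k.2 l (zb.1 k) (y.1 k)) _)
  have h' := mul_le_mul_of_nonneg_left h hwh
  unfold subObj penObj sqDist
  linarith

/-- The hypothesis on the weights makes the subproblem a majorant of the penalized problem. -/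
theorem penObj_le_subObj {β : Fin P.N → P.LIdx → ℝ≥0}
    (hβ : ∀ y y', P.BaseFeasible y → P.BaseFeasible y' → ∀ (k : Fin P.N) (l : P.LIdx),
      ‖P.g k l (y.1 k) - P.g k l (y'.1 k)‖ ≤ β k l * ‖y.1 k - y'.1 k‖)
    (hwh : 0 ≤ wh) (hwtr : 0 ≤ wtr) (hw : ∀ k, wh * ∑ l, (β k l : ℝ) ≤ 2 * wtr)
    {zb y : P.Dec} (hzb : P.BaseFeasible zb) (hy : P.BaseFeasible y) :
    P.penObj wh y ≤ P.subObj wh wtr zb y := by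
  have hdesc : ∀ (k : Fin P.N) (l : P.LIdx), P.h k l (y.1 k) - P.ε ≤
      P.linViol zb y k l + β k l / 2 * ‖y.1 k - zb.1 k‖ ^ 2 := by
    intro k l
    have h := le_add_inner_add_of_subgradient (f := P.h k l) (g := P.g k l)
      (h_add_inner_g_le k.2 l) (x := zb.1 k) (d := y.1 k - zb.1 k) (β := β k l) (by
        rintro s ⟨hs0, hs1⟩
        have h := hβ _ _ (hzb.comb hy (sub_nonneg.mpr hs1) hs0 (by ring)) hzb k l
        have hpt : ((1 - s) • zb + s • y).1 k = zb.1 k + s • (y.1 k - zb.1 k) := by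
          change (1 - s) • zb.1 k + s • y.1 k = _
          module
        rwa [hpt, add_sub_cancel_left] at h)
    rw [add_sub_cancel] at h
    unfold linViol
    linarith
  have hviol : P.violation y ≤ ∑ k : Fin P.N, ∑ l : P.LIdx,
      (max 0 (P.linViol zb y k l) + β k l / 2 * ‖y.1 k - zb.1 k‖ ^ 2) := by
    refine Finset.sum_le_sum fun k _ => Finset.sum_le_sum fun l _ => max_le ?_ ?_
    · have := le_max_left 0 (P.linViol zb y k l)
      positivity
    · linarith [hdesc k l, le_max_right 0 (P.linViol zb y k l)]
  have hquad : wh * ∑ k : Fin P.N, ∑ l : P.LIdx, (β k l : ℝ) / 2 * ‖y.1 k - zb.1 k‖ ^ 2 ≤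
      wtr * ∑ k : Fin P.N, ‖y.1 k - zb.1 k‖ ^ 2 := by
    rw [Finset.mul_sum, Finset.mul_sum]
    refine Finset.sum_le_sum fun k _ => ?_
    rw [← Finset.sum_mul, ← Finset.sum_div, ← mul_assoc]
    exact mul_le_mul_of_nonneg_right (by linarith [hw k]) (sq_nonneg _)
  simp only [Finset.sum_add_distrib] at hviol
  have h1 := mul_le_mul_of_nonneg_left hviol hwh
  have h2 := mul_nonneg hwtr (sq_nonneg ‖y.2 - zb.2‖)
  unfold penObj subObj
  linarith

/-- The three-point inequality of the proximal point method, for a step between feasible points. -/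
theorem penObj_add_sqDist_le {β : Fin P.N → P.LIdx → ℝ≥0}
    (hβ : ∀ y y', P.BaseFeasible y → P.BaseFeasible y' → ∀ (k : Fin P.N) (l : P.LIdx),
      ‖P.g k l (y.1 k) - P.g k l (y'.1 k)‖ ≤ β k l * ‖y.1 k - y'.1 k‖)
    (hwh : 0 ≤ wh) (hwtr : 0 ≤ wtr) (hw : ∀ k, wh * ∑ l, (β k l : ℝ) ≤ 2 * wtr)
    {zb x y : P.Dec} (hzb : P.BaseFeasible zb) (hx : P.IsSubSolution wh wtr zb x)
    (hy : P.BaseFeasible y) :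
    P.penObj wh x + wtr * P.sqDist y x ≤ P.penObj wh y + wtr * P.sqDist y zb := by
  linarith [penObj_le_subObj hβ hwh hwtr hw hzb hx.1, hx.add_sqDist_le hwh hy,
    subObj_le_penObj_add (wtr := wtr) hwh zb y]

/-! ### Exactness of the penalty and lower semicontinuity -/

/-- Convexity and a strictly feasible point bound the possible gain in cost by a multiple of the
violation. -/
theorem exists_exact_penalty {zs ys : P.Dec} (hzs : P.IsSolution zs) (hys : P.BaseFeasible ys)
    (hstrict : ∀ (k : Fin P.N) (l : P.LIdx), P.h k l (ys.1 k) < P.ε) :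
    ∃ wbar : ℝ, ∀ z, P.BaseFeasible z →
      P.J (P.Qnode zs 0) ≤ P.J (P.Qnode z 0) + wbar * P.violation z := by
  obtain ⟨δ, hδ, hδle⟩ : ∃ δ : ℝ, 0 < δ ∧ ∀ (k : Fin P.N) (l : P.LIdx),
      P.h k l (ys.1 k) + δ ≤ P.ε := by
    have : Nonempty (Fin P.N × P.LIdx) := ⟨⟨0, P.N_pos⟩, .inl ()⟩
    obtain ⟨i, hi⟩ := Finite.exists_min fun i : Fin P.N × P.LIdx => P.ε - P.h i.1 i.2 (ys.1 i.1)
    exact ⟨_, sub_pos.mpr (hstrict i.1 i.2), fun k l => by linarith [hi (k, l)]⟩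
  refine ⟨(P.J (P.Qnode ys 0) - P.J (P.Qnode zs 0)) / δ, fun z hz => ?_⟩
  have hu := violation_nonneg z
  set u := P.violation z with hu_def
  have huδ : 0 < u + δ := by linarith
  -- Moving from `z` towards the strictly feasible point by the fraction `u / (u + δ)` restores
  -- feasibility.
  have hsum : δ / (u + δ) + u / (u + δ) = 1 := by
    rw [← add_div, add_comm, div_self huδ.ne']
  have hfeas : P.MainFeasible ((δ / (u + δ)) • z + (u / (u + δ)) • ys) := by
    refine ⟨hz.comb hys (by positivity) (by positivity) hsum, fun k l => ?_⟩
    have hconv := (convexOn_h k.2 l).2 (mem_univ (z.1 k)) (mem_univ (ys.1 k))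
      (div_nonneg hδ.le huδ.le) (div_nonneg hu huδ.le) hsum
    simp only [smul_eq_mul] at hconv
    have h1 : P.h k l (z.1 k) ≤ P.ε + u := by linarith [h_sub_le_violation z k l]
    have h2 : P.h k l (ys.1 k) ≤ P.ε - δ := by linarith [hδle k l]
    calc P.h k l (((δ / (u + δ)) • z + (u / (u + δ)) • ys).1 k)
        ≤ δ / (u + δ) * P.h k l (z.1 k) + u / (u + δ) * P.h k l (ys.1 k) := hconv
      _ ≤ δ / (u + δ) * (P.ε + u) + u / (u + δ) * (P.ε - δ) := by gcongr
      _ = P.ε := by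
        field_simp
        ring
  have hJ := (hzs.2 _ hfeas).trans (J_comb_le hz hys (div_nonneg hδ.le huδ.le)
    (div_nonneg hu huδ.le) hsum)
  have hJ' : (u + δ) * P.J (P.Qnode zs 0) ≤
      δ * P.J (P.Qnode z 0) + u * P.J (P.Qnode ys 0) := by
    have h := mul_le_mul_of_nonneg_left hJ huδ.le
    refine h.trans_eq ?_
    field_simp
  rw [div_mul_eq_mul_div, ← sub_le_iff_le_add', le_div_iff₀ hδ]
  linarith

theorem isSolution_of_penObj_le {zs z : P.Dec} {wbar : ℝ} (hzs : P.IsSolution zs)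
    (hbar : P.J (P.Qnode zs 0) ≤ P.J (P.Qnode z 0) + wbar * P.violation z) (hw : wbar < wh)
    (hz : P.BaseFeasible z) (hle : P.penObj wh z ≤ P.J (P.Qnode zs 0)) : P.IsSolution z := by
  have hv : P.violation z ≤ 0 := by
    unfold penObj at hle
    by_contra hpos
    have := mul_pos (sub_pos.mpr hw) (not_le.mp hpos)
    linarith
  have hfeas := hz.mainFeasible hv
  refine ⟨hfeas, fun y hy => le_trans ?_ (hzs.2 y hy)⟩
  unfold penObj at hle
  rwa [hfeas.violation_eq_zero, mul_zero, add_zero] at hle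

/-- Lower semicontinuity of the penalty function: cluster points of feasible sequences are
feasible, and upper bounds of the penalty function pass to them. -/
theorem baseFeasible_and_penObj_le_of_mapClusterPt (hwh : 0 ≤ wh) {z : ℕ → P.Dec} {zs : P.Dec}
    (hcl : MapClusterPt zs atTop z) (hz : ∀ᶠ i in atTop, P.BaseFeasible (z i)) {c : ℝ}
    (hc : ∀ᶠ i in atTop, P.penObj wh (z i) ≤ c) :
    P.BaseFeasible zs ∧ P.penObj wh zs ≤ c := by
  have hclosed : ∀ {S U : Set P.Dec}, IsClosed S → U ∈ 𝓝 zs →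
      (∀ᶠ i in atTop, z i ∈ U → z i ∈ S) → zs ∈ S := by
    intro S U hS hU hev
    rw [← hS.closure_eq, mem_closure_iff_nhds]
    intro V hV
    obtain ⟨i, hi, hi'⟩ := ((mapClusterPt_iff_frequently.mp hcl _ (inter_mem hV hU)).and_eventually
      hev).exists
    exact ⟨z i, hi.1, hi' hi.2⟩
  have hcore := hclosed P.isClosed_setOf_constraints univ_mem (hz.mono fun i hi _ =>
    ⟨hi.1, hi.2.1, hi.2.2.1, hi.2.2.2.1⟩)
  have hJ : ∀ η : ℝ, 0 < η → P.Qnode zs 0 ∈ P.domJ ∧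
      P.J (P.Qnode zs 0) ≤ c - wh * (P.violation zs - η) := by
    intro η hη
    have hU : {x | P.violation zs - η < P.violation x} ∈ 𝓝 zs :=
      P.continuous_violation.continuousAt.eventually (lt_mem_nhds (by linarith))
    refine hclosed ((P.closed_J (c - wh * (P.violation zs - η))).preimage (P.continuous_Qnode 0))
      hU ?_
    filter_upwards [hz, hc] with i hi hci hiU
    refine ⟨hi.2.2.2.2, ?_⟩
    have := mul_le_mul_of_nonneg_left (le_of_lt hiU) hwh
    unfold penObj at hci
    linarith
  refine ⟨⟨hcore.1, hcore.2.1, hcore.2.2.1, hcore.2.2.2, (hJ 1 one_pos).1⟩, ?_⟩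
  have hlim : Tendsto (fun η : ℝ => c + wh * η) (𝓝[>] 0) (𝓝 c) := by
    have : Continuous fun η : ℝ => c + wh * η := by fun_prop
    simpa using (this.tendsto 0).mono_left nhdsWithin_le_nhds
  refine ge_of_tendsto hlim ?_
  filter_upwards [self_mem_nhdsWithin] with η hη
  unfold penObj
  linarith [(hJ η hη).2]

/-! ### Convergence of the SCvx sequence -/

/-- The convergence analysis uses of a sequence only that it consists of base-feasible points and
satisfies the three-point inequality. -/
structure IsProximalSequence (wh wtr : ℝ) (u : ℕ → P.Dec) : Prop where
  feasible : ∀ i, P.BaseFeasible (u i)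
  step : ∀ i y, P.BaseFeasible y →
    P.penObj wh (u (i + 1)) + wtr * P.sqDist y (u (i + 1)) ≤
      P.penObj wh y + wtr * P.sqDist y (u i)

namespace IsProximalSequence

variable {u : ℕ → P.Dec}

theorem antitone (hu : IsProximalSequence wh wtr u) (hwtr : 0 ≤ wtr) :
    Antitone fun i => P.penObj wh (u i) := by
  refine antitone_nat_of_succ_le fun i => ?_
  have h := hu.step i (u i) (hu.feasible i)
  rw [sqDist_self] at h
  linarith [mul_nonneg hwtr (sqDist_nonneg (u i) (u (i + 1)))]

/-- The penalty function values approach the infimum. -/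
theorem eventually_penObj_le (hu : IsProximalSequence wh wtr u) (hwtr : 0 ≤ wtr) {y : P.Dec}
    (hy : P.BaseFeasible y) {η : ℝ} (hη : 0 < η) :
    ∀ᶠ i in atTop, P.penObj wh (u i) ≤ P.penObj wh y + η := by
  obtain ⟨j, hj⟩ : ∃ j, P.penObj wh (u j) ≤ P.penObj wh y + η := by
    by_contra! hcon
    -- Otherwise the weighted distance to `y` would decrease by `η` in each step.
    have hdec : ∀ m : ℕ, wtr * P.sqDist y (u m) ≤ wtr * P.sqDist y (u 0) - m * η := by
      intro m
      induction m with
      | zero => simp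
      | succ m ih =>
        have h1 := hu.step m y hy
        have h2 := hcon (m + 1)
        push_cast
        linarith
    obtain ⟨m, hm⟩ := exists_nat_gt (wtr * P.sqDist y (u 0) / η)
    rw [div_lt_iff₀ hη] at hm
    linarith [hdec m, mul_nonneg hwtr (sqDist_nonneg y (u m))]
  filter_upwards [eventually_ge_atTop j] with i hi
  exact (hu.antitone hwtr hi).trans hj

theorem penObj_le_of_mapClusterPt (hu : IsProximalSequence wh wtr u) (hwh : 0 ≤ wh)
    (hwtr : 0 ≤ wtr) {zs : P.Dec} (hcl : MapClusterPt zs atTop u) {y : P.Dec}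
    (hy : P.BaseFeasible y) : P.BaseFeasible zs ∧ P.penObj wh zs ≤ P.penObj wh y := by
  have h : ∀ η : ℝ, 0 < η → P.BaseFeasible zs ∧ P.penObj wh zs ≤ P.penObj wh y + η :=
    fun η hη => baseFeasible_and_penObj_le_of_mapClusterPt hwh hcl
      (Eventually.of_forall hu.feasible) (hu.eventually_penObj_le hwtr hy hη)
  exact ⟨(h 1 one_pos).1, le_of_forall_pos_le_add fun η hη => (h η hη).2⟩

/-- The distance to a minimizer of the penalty function is nonincreasing. -/
theorem antitone_sqDist (hu : IsProximalSequence wh wtr u) (hwtr : 0 < wtr) {y : P.Dec}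
    (hy : P.BaseFeasible y) (hmin : ∀ x, P.BaseFeasible x → P.penObj wh y ≤ P.penObj wh x) :
    Antitone fun i => P.sqDist y (u i) := by
  refine antitone_nat_of_succ_le fun i => ?_
  have h := hu.step i y hy
  have h' := hmin _ (hu.feasible (i + 1))
  exact le_of_mul_le_mul_left (by linarith) hwtr

/-- If the penalty function has a minimizer, the sequence converges to a minimizer. -/
theorem exists_tendsto (hu : IsProximalSequence wh wtr u) (hwh : 0 ≤ wh) (hwtr : 0 < wtr)
    {y : P.Dec} (hy : P.BaseFeasible y)
    (hmin : ∀ x, P.BaseFeasible x → P.penObj wh y ≤ P.penObj wh x) :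
    ∃ zs, P.BaseFeasible zs ∧ P.penObj wh zs ≤ P.penObj wh y ∧ Tendsto u atTop (𝓝 zs) := by
  have hball : ∀ i, u i ∈ Metric.closedBall y (√(P.sqDist y (u 0))) := fun i =>
    (dist_le_sqrt_sqDist y (u i)).trans
      (Real.sqrt_le_sqrt (hu.antitone_sqDist hwtr hy hmin (Nat.zero_le i)))
  obtain ⟨zs, -, hcl⟩ := (isCompact_closedBall y (√(P.sqDist y (u 0)))).exists_mapClusterPt
    (f := atTop) (u := u) (tendsto_principal.mpr (Eventually.of_forall hball))
  obtain ⟨hzs, hle⟩ := hu.penObj_le_of_mapClusterPt hwh hwtr.le hcl hy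
  refine ⟨zs, hzs, hle, ?_⟩
  have hanti := hu.antitone_sqDist hwtr hzs fun x hx => hle.trans (hmin x hx)
  have hlim : Tendsto (fun i => √(P.sqDist zs (u i))) atTop (𝓝 0) := by
    rw [← Real.sqrt_zero]
    refine Tendsto.sqrt (tendsto_order.mpr ⟨fun a ha => Eventually.of_forall fun i =>
      ha.trans_le (sqDist_nonneg _ _), fun a ha => ?_⟩)
    have hnhds : {x | P.sqDist zs x < a} ∈ 𝓝 zs :=
      (continuous_sqDist_left zs).continuousAt.eventually
        (gt_mem_nhds (by simpa only [sqDist_self] using ha))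
    obtain ⟨j, hj⟩ := (mapClusterPt_iff_frequently.mp hcl _ hnhds).exists
    filter_upwards [eventually_ge_atTop j] with i hi
    exact (hanti hi).trans_lt hj
  exact tendsto_iff_dist_tendsto_zero.mpr
    (squeeze_zero (fun _ => dist_nonneg) (fun i => dist_le_sqrt_sqDist zs (u i)) hlim)

end IsProximalSequence

/-- The initial guess need not be feasible, so the analysis starts with the first iterate. -/
theorem IsSCvxSequence.isProximalSequence {β : Fin P.N → P.LIdx → ℝ≥0} {z : ℕ → P.Dec}
    (hz : P.IsSCvxSequence wh wtr z)
    (hβ : ∀ y y', P.BaseFeasible y → P.BaseFeasible y' → ∀ (k : Fin P.N) (l : P.LIdx),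
      ‖P.g k l (y.1 k) - P.g k l (y'.1 k)‖ ≤ β k l * ‖y.1 k - y'.1 k‖)
    (hwh : 0 ≤ wh) (hwtr : 0 ≤ wtr) (hw : ∀ k, wh * ∑ l, (β k l : ℝ) ≤ 2 * wtr) :
    IsProximalSequence wh wtr fun i => z (i + 1) where
  feasible i := (hz i).1
  step i _ hy := penObj_add_sqDist_le hβ hwh hwtr hw (hz i).1 (hz (i + 1)) hy

end FunnelProblem

theorem mainTheorem9 (P : FunnelProblem)
    (hsol : ∃ z, P.IsSolution z)
    (hstrict : ∃ z, P.BaseFeasible z ∧ ∀ (k : Fin P.N) (l : P.LIdx), P.h k l (z.1 k) < P.ε) :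
    ∃ wbar : ℝ, ∀ (β : Fin P.N → P.LIdx → ℝ≥0) (wh wtr : ℝ) (z : ℕ → P.Dec),
      (∀ y y', P.BaseFeasible y → P.BaseFeasible y' → ∀ (k : Fin P.N) (l : P.LIdx),
        ‖P.g k l (y.1 k) - P.g k l (y'.1 k)‖ ≤ β k l * ‖y.1 k - y'.1 k‖) →
      0 < wh → 0 < wtr → (∀ k, wh * ∑ l, (β k l : ℝ) ≤ 2 * wtr) →
      P.IsSCvxSequence wh wtr z →
      (∀ (i : ℕ) (k : Fin P.N) (l : P.LIdx),
        ∀ᵐ t ∂(volume.restrict (Icc (P.node k) (P.node (k + 1)))),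
          topMult (P.LChi k l t ((z i).1 k)) = 1) →
      (∀ (i : ℕ) (k : Fin P.N) (l : P.LIdx), 1 < P.p l →
        HasGradientAt (P.h k l) (P.g k l ((z i).1 k)) ((z i).1 k)) ∧
      (wbar < wh → ∃ zs, P.IsSolution zs ∧ Tendsto z atTop (𝓝 zs)) ∧
      (∀ zs, MapClusterPt zs atTop z → P.MainFeasible zs → P.IsSolution zs) := by
  obtain ⟨zsol, hzsol⟩ := hsol
  obtain ⟨ys, hys, hys'⟩ := hstrict
  obtain ⟨wbar, hbar⟩ := FunnelProblem.exists_exact_penalty hzsol hys hys'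
  refine ⟨wbar, fun β wh wtr z hβ hwh hwtr hw hz hsimple => ⟨fun i k l hp =>
    FunnelProblem.hasGradientAt_h k.2 l hp (hsimple i k l), fun hwbar => ?_, fun zs hcl hzs => ?_⟩⟩
  · have hu := hz.isProximalSequence hβ hwh.le hwtr.le hw
    have hval : P.penObj wh zsol = P.J (P.Qnode zsol 0) := by
      rw [FunnelProblem.penObj, hzsol.1.violation_eq_zero, mul_zero, add_zero]
    obtain ⟨zs, hzs, hle, hlim⟩ := hu.exists_tendsto hwh.le hwtr hzsol.1.1 fun x hx => by
      have h1 := mul_le_mul_of_nonneg_right hwbar.le (FunnelProblem.violation_nonneg x)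
      rw [hval, FunnelProblem.penObj]
      linarith [hbar x hx]
    exact ⟨zs, FunnelProblem.isSolution_of_penObj_le hzsol (hbar zs hzs) hwbar hzs (hval ▸ hle),
      (tendsto_add_atTop_iff_nat 1).mp hlim⟩
  · have hu := hz.isProximalSequence hβ hwh.le hwtr.le hw
    have hcl' : MapClusterPt zs atTop fun i => z (i + 1) := by
      rw [mapClusterPt_iff_frequently] at hcl ⊢
      intro s hs
      refine (frequently_atTop.mpr fun n => ?_)
      obtain ⟨m, hm, hms⟩ := frequently_atTop.mp (hcl s hs) (n + 1)
      exact ⟨m - 1, by omega, by rwa [Nat.sub_add_cancel (by omega)]⟩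
    refine ⟨hzs, fun y hy => ?_⟩
    have h := (hu.penObj_le_of_mapClusterPt hwh.le hwtr.le hcl' hy.1).2
    simpa [FunnelProblem.penObj, hzs.violation_eq_zero, hy.violation_eq_zero] using h

end
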